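/- Let $H^2=H^2(\mathbb D)$ be the Hardy space of the unit disc, identified through boundary values with the closed subspace of $L^2(\mathbb T)$ of functions whose Fourier coefficients of negative index vanish. For $\varphi\in L^\infty(\mathbb T)$ let $T_\varphi f=P_{H^2}(\varphi f)$ be the Toeplitz operator on $H^2$. An inner function is a $\theta\in H^2$ with $|\theta|=1$ a.e. on $\mathbb T$ (unimodular constants are allowed). For $\theta$ inner or $\theta\equiv 0$ put $K_\theta=H^2\ominus\theta H^2$; thus $K_0=H^2$. A subspace $M\subseteq H^2$ is nearly $T^{-1}$-invariant if $g\in H^2$ and $Tg\in M$ imply $g\in M$. Let $\psi(z)=\lambda\frac{a-z}{1-\bar a z}$ with $|\lambda|=1$ and $a\in\mathbb D$ be an automorphism of the disc with zero $a$, and write $C_\psi f=f\circ\psi$. (1) A linear subspace $M\subseteq H^2$ is closed and nearly $T_\psi^{-1}$-invariant if and only if $$M=C_\psi(uK_\theta)=\{(u\circ\psi)(f\circ\psi): f\in K_\theta\}$$ for some $u\in H^2$ with $u(0)\neq 0$ and some $\theta$ that is inner or identically $0$, such that multiplication by $u$ maps $K_\theta$ isometrically into $H^2$. (2) Let $u\in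 H^2$ and let $\theta$ be inner or identically $0$. Then $\theta\circ\psi\in H^2$ (and it is inner if $\theta$ is), the symbol $(\bar\theta\circ\psi)\psi/z$ belongs to $L^\infty(\mathbb T)$, and, as sets of analytic functions on $\mathbb D$, $$C_\psi(uK_\theta)=(u\circ\psi)\,\mathrm{Ker}\,T_{(\bar\theta\circ\psi)\psi/z}.$$ More explicitly, if $\theta(0)=0$, then $z(\theta\circ\psi)/\psi$ extends to a function in $H^2$ (inner if $\theta$ is) and $$C_\psi(uK_\theta)=(u\circ\psi)\,K_{z(\theta\circ\psi)/\psi};$$ if $\theta(0)\neq0$, then $$C_\psi(uK_\theta)=(1-\bar a z)(u\circ\psi)\,K_{\theta\circ\psi}.$$ -/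

import Mathlib

open MeasureTheory Complex
open scoped ComplexConjugate ENNReal Complex.UnitDisc

noncomputable section

namespace HardyDisc

instance twoPiPos : Fact (0 < 2 * Real.pi) := ⟨Real.two_pi_pos⟩

/-- The unit circle `𝕋`, parametrized by the angle `t` modulo `2π`. -/
abbrev Torus : Type := AddCircle (2 * Real.pi)

/-- Normalized Lebesgue measure on the unit circle. -/
abbrev arc : Measure Torus := AddCircle.haarAddCircle

/-- The point `ζ = e^{it}` of the unit circle with angle `t`. -/
def pt (t : Torus) : ℂ := (AddCircle.toCircle t : ℂ)

/-- The Hardy space `H²`, as the subspace of those elements of `L²(𝕋)` whose Fourier coefficients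
of negative index vanish. -/
def hardy : Submodule ℂ (Lp ℂ 2 arc) where
  carrier := {f | ∀ n : ℤ, n < 0 → fourierCoeff (f : Torus → ℂ) n = 0}
  zero_mem' := by
    intro n _
    rw [← fourierBasis_repr]
    simp
  add_mem' := by
    intro f g hf hg n hn
    have h1 := hf n hn
    have h2 := hg n hn
    rw [← fourierBasis_repr] at h1 h2 ⊢
    simp [h1, h2]
  smul_mem' := by
    intro c f hf n hn
    have h1 := hf n hn
    rw [← fourierBasis_repr] at h1 ⊢
    simp [h1]

theorem isClosed_hardy : IsClosed (hardy : Set (Lp ℂ 2 arc)) := by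
  have h : (hardy : Set (Lp ℂ 2 arc)) =
      ⋂ n : ℤ, ⋂ _ : n < 0, {f | (fourierBasis.repr f : ℤ → ℂ) n = 0} := by
    ext f
    simp only [Set.mem_iInter, Set.mem_ofPred_eq, fourierBasis_repr]
    rfl
  rw [h]
  refine isClosed_iInter fun n => isClosed_iInter fun _ => ?_
  have hc : Continuous fun f : Lp ℂ 2 arc => (fourierBasis.repr f : ℤ → ℂ) n := by
    have : (fun f : Lp ℂ 2 arc => (fourierBasis.repr f : ℤ → ℂ) n) =
        fun f => inner ℂ (fourierBasis n) f := by
      funext f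
      exact HilbertBasis.repr_apply_apply _ _ _
    rw [this]
    fun_prop
  exact isClosed_singleton.preimage hc

instance completeSpace_hardy : CompleteSpace hardy :=
  isClosed_hardy.completeSpace_coe

/-- The Hardy space `H²(𝔻)` as a Hilbert space; an element is identified with its boundary
function, and its values in the disc are given by `H2.eval`. -/
abbrev H2 : Type := hardy

/-- The boundary function of an element of `H²(𝔻)` (defined almost everywhere). -/
def H2.bdry (f : H2) : Torus → ℂ := ((f : Lp ℂ 2 arc) : Torus → ℂ)

/-- The analytic function on the disc given by an element of `H²(𝔻)`:
`f(z) = ∫ f(ζ) / (1 - ζ̄ z) dm(ζ)`. -/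
def H2.eval (f : H2) (z : 𝔻) : ℂ := ∫ t, f.bdry t / (1 - conj (pt t) * (z : ℂ)) ∂arc

/-- The functions on the disc that belong to a subspace of `H²(𝔻)`. -/
def fns (M : Submodule ℂ H2) : Set (𝔻 → ℂ) := H2.eval '' (M : Set H2)

/-- The set `w F = {w f : f ∈ F}` of pointwise products. -/
def mulSet (w : 𝔻 → ℂ) (F : Set (𝔻 → ℂ)) : Set (𝔻 → ℂ) := (fun f => w * f) '' F

/-- The image `{f ∘ ψ : f ∈ F}` of a set of functions under the composition operator `C_ψ`. -/
def compSet (ψ : 𝔻 → 𝔻) (F : Set (𝔻 → ℂ)) : Set (𝔻 → ℂ) := (fun f => f ∘ ψ) '' F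

/-- The Toeplitz operator `T_φ f = P (φ f)` with symbol `φ ∈ L^∞(𝕋)`, where `P` is the orthogonal
projection of `L²(𝕋)` onto `H²`. -/
def toeplitz (φ : Lp ℂ ∞ arc) : H2 →L[ℂ] H2 :=
  hardy.orthogonalProjectionOnto ∘L
    ((ContinuousLinearMap.mul ℂ ℂ).holderL arc ∞ 2 2 φ) ∘L hardy.subtypeL

/-- The kernel of a Toeplitz operator. -/
def toeplitzKer (φ : Lp ℂ ∞ arc) : Submodule ℂ H2 := LinearMap.ker (toeplitz φ).toLinearMap

/-- `θ ∈ H²` is inner: `|θ| = 1` almost everywhere on the circle. -/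
def IsInner (θ : H2) : Prop := ∀ᵐ t ∂arc, ‖θ.bdry t‖ = 1

/-- The subspace `θ H²` of all `g ∈ H²` of the form `g = θ h` with `h ∈ H²`. -/
def multiples (θ : H2) : Submodule ℂ H2 where
  carrier := {g | ∃ h : H2, g.bdry =ᵐ[arc] fun t => θ.bdry t * h.bdry t}
  zero_mem' := by
    refine ⟨0, ?_⟩
    have h0 : (0 : H2).bdry =ᵐ[arc] 0 := Lp.coeFn_zero ℂ 2 arc
    filter_upwards [h0] with t ht
    simp [ht]
  add_mem' := by
    rintro g₁ g₂ ⟨h₁, e₁⟩ ⟨h₂, e₂⟩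
    refine ⟨h₁ + h₂, ?_⟩
    have a₁ : (g₁ + g₂).bdry =ᵐ[arc] g₁.bdry + g₂.bdry := Lp.coeFn_add _ _
    have a₂ : (h₁ + h₂).bdry =ᵐ[arc] h₁.bdry + h₂.bdry := Lp.coeFn_add _ _
    filter_upwards [a₁, a₂, e₁, e₂] with t b₁ b₂ b₃ b₄
    simp [b₁, b₂, b₃, b₄, mul_add]
  smul_mem' := by
    rintro c g ⟨h, e⟩
    refine ⟨c • h, ?_⟩
    have a₁ : (c • g).bdry =ᵐ[arc] c • g.bdry := Lp.coeFn_smul _ _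
    have a₂ : (c • h).bdry =ᵐ[arc] c • h.bdry := Lp.coeFn_smul _ _
    filter_upwards [a₁, a₂, e] with t b₁ b₂ b₃
    simp [b₁, b₂, b₃, mul_left_comm]

/-- The model space `K_θ = H² ⊖ θ H²`; thus `K_0 = H²`. -/
def modelSpace (θ : H2) : Submodule ℂ H2 := (multiples θ)ᗮ

/-- Multiplication by `u` maps `K` isometrically into `H²(𝔻)`. -/
def IsIsometricMultiplier (u : H2) (K : Submodule ℂ H2) : Prop :=
  ∀ f ∈ K, ∃ g : H2, g.eval = u.eval * f.eval ∧ ‖g‖ = ‖f‖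

/-- `M` is nearly `T⁻¹`-invariant: `T g ∈ M` implies `g ∈ M`. -/
def IsNearlyInvInvariant (T : H2 →L[ℂ] H2) (M : Submodule ℂ H2) : Prop :=
  ∀ g : H2, T g ∈ M → g ∈ M

theorem one_sub_ne_zero (a : 𝔻) {z : ℂ} (hz : ‖z‖ ≤ 1) : 1 - conj (a : ℂ) * z ≠ 0 := by
  intro h
  have h1 : ‖conj (a : ℂ) * z‖ = 1 := by
    rw [← sub_eq_zero.mp h, norm_one]
  rw [norm_mul, RCLike.norm_conj] at h1
  have h2 := a.norm_lt_one
  have h3 := norm_nonneg (a : ℂ)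
  nlinarith

theorem norm_aut_lt_one (lam : Circle) (a z : 𝔻) :
    ‖(lam : ℂ) * (((a : ℂ) - z) / (1 - conj (a : ℂ) * z))‖ < 1 := by
  have hne := one_sub_ne_zero a z.norm_lt_one.le
  have ha := a.normSq_lt_one
  have hz := z.normSq_lt_one
  rw [norm_mul, Circle.norm_coe, one_mul, norm_div, div_lt_one (norm_pos_iff.mpr hne),
    ← sq_lt_sq₀ (norm_nonneg _) (norm_nonneg _), ← normSq_eq_norm_sq, ← normSq_eq_norm_sq]
  simp only [normSq_apply, sub_re, sub_im, mul_re, mul_im, one_re, one_im, conj_re, conj_im] at *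
  nlinarith [mul_pos (sub_pos.mpr ha) (sub_pos.mpr hz)]

/-- The automorphism `ψ(z) = λ (a - z) / (1 - ā z)` of the disc, with zero `a`. -/
def aut (lam : Circle) (a : 𝔻) (z : 𝔻) : 𝔻 :=
  UnitDisc.mk ((lam : ℂ) * (((a : ℂ) - z) / (1 - conj (a : ℂ) * z))) (norm_aut_lt_one lam a z)

/-- The same automorphism on the circle, `t ↦ ψ(e^{it})`. -/
def autBdry (lam : Circle) (a : 𝔻) : C(Torus, ℂ) where
  toFun t := (lam : ℂ) * (((a : ℂ) - pt t) / (1 - conj (a : ℂ) * pt t))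
  continuous_toFun := by
    have hpt : Continuous pt := continuous_subtype_val.comp AddCircle.continuous_toCircle
    refine continuous_const.mul ((continuous_const.sub hpt).div
      (continuous_const.sub (continuous_const.mul hpt)) fun t => ?_)
    exact one_sub_ne_zero a (Circle.norm_coe _).le

/-- The operator `T_ψ` on `H²` for the automorphism `ψ`. -/
def toeplitzAut (lam : Circle) (a : 𝔻) : H2 →L[ℂ] H2 :=
  toeplitz (ContinuousMap.toLp ∞ arc ℂ (autBdry lam a))

/-- For `Θ = θ ∘ ψ`, the symbol `(θ̄ ∘ ψ) ψ / z` on the circle. -/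
def symbolFn (lam : Circle) (a : 𝔻) (Θ : H2) (t : Torus) : ℂ :=
  conj (Θ.bdry t) * autBdry lam a t / pt t

end HardyDisc

end

open HardyDisc

noncomputable section

namespace HardyDisc

open Filter Topology

/-! ### Fourier analysis on the circle -/

/-! Composition with `ψ` is a bounded bijection `C_ψ` of `H²`, with inverse `C_{ψ⁻¹}`, and `T_ψ C_ψ
= C_ψ S` for the shift `S f = z f`. Hence `M` is closed and nearly `T_ψ⁻¹`-invariant exactly when `N
= C_ψ⁻¹ M` is closed and nearly `S⁻¹`-invariant, and part (1) becomes Hitt's theorem: such `N` are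
the spaces `u K_θ` with `u(0) ≠ 0` and `u` an isometric multiplier on `K_θ`.

For Hitt's theorem, take a unit vector `u ∈ N` orthogonal to the elements of `N` vanishing at 0.
Every `f ∈ N` is `⟪u, f⟫ u + z R f` with `R f = S*(f - ⟪u, f⟫ u) ∈ N`, an orthogonal decomposition.
Iterating it expands `f / u` in a power series with coefficients `⟪u, Rʲ f⟫`. The map `f ↦ f / u` is
isometric provided `Rⁿ f → 0`, and it intertwines `R` with `S*`, so its range is closed and
`S*`-invariant, hence a model space by Beurling's theorem (`exists_eq_modelSpace`).

The analytic core is `tendsto_pow_rankOne_perturbation`, which gives `Rⁿ → 0` strongly. The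
obstruction is the limit `A` of `R*ⁿ Rⁿ`. It is controlled by the single vector `p = R* A T u` with
`T = S*`, and `p = 0` because an Abel sum tending to 0 is also an average, against the density
`|u|²`, of resolvent values with real part at least `‖p‖² / 2`.

Part (2) is a computation on the circle. Membership `f ∈ K_θ` means `z̄ θ f̄ ∈ H²`. Composing with
`ψ` turns this into `(θ∘ψ) conj(f∘ψ) / ψ ∈ H²`, which is also the condition for membership in the
Toeplitz kernel and in `K_{z(θ∘ψ)/ψ}`. After removing the factor `1 - ā z`, which is invertible
among bounded analytic functions, it is the condition for `K_{θ∘ψ}`. -/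

theorem continuous_pt : Continuous pt :=
  continuous_subtype_val.comp AddCircle.continuous_toCircle

@[simp]
theorem norm_pt (t : Torus) : ‖pt t‖ = 1 := Circle.norm_coe _

theorem pt_ne_zero (t : Torus) : pt t ≠ 0 := Circle.coe_ne_zero _

theorem conj_pt (t : Torus) : conj (pt t) = (pt t)⁻¹ := by
  rw [pt, ← Circle.coe_inv, Circle.coe_inv_eq_conj]

theorem fourier_eq_pt (n : ℤ) (t : Torus) : fourier n t = pt t ^ n := by
  rw [fourier_apply, AddCircle.toCircle_zsmul, pt, Circle.coe_zpow]

theorem fourierCoeff_eq (q : Torus → ℂ) (n : ℤ) :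
    fourierCoeff q n = ∫ t, pt t ^ (-n) * q t ∂arc := by
  simp only [fourierCoeff, fourier_eq_pt, smul_eq_mul]

/-- Integration of continuous functions against `q ν`. -/
def integralMul (ν : Measure Torus) (q : Torus → ℂ) (hq : Integrable q ν) :
    C(Torus, ℂ) →L[ℂ] ℂ :=
  LinearMap.mkContinuous
    { toFun := fun φ => ∫ t, φ t * q t ∂ν
      map_add' := fun φ ψ => by
        simp only [ContinuousMap.add_apply, add_mul]
        exact integral_add (hq.bdd_mul φ.continuous.aestronglyMeasurable
            (ae_of_all _ fun t => φ.norm_coe_le_norm t))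
          (hq.bdd_mul ψ.continuous.aestronglyMeasurable
            (ae_of_all _ fun t => ψ.norm_coe_le_norm t))
      map_smul' := fun c φ => by
        simp only [ContinuousMap.smul_apply, smul_eq_mul, mul_assoc, RingHom.id_apply]
        exact integral_const_mul _ _ }
    (∫ t, ‖q t‖ ∂ν) fun φ => by
      rw [← integral_mul_const]
      refine norm_integral_le_of_norm_le (hq.norm.mul_const _) (ae_of_all _ fun t => ?_)
      rw [norm_mul, mul_comm]
      exact mul_le_mul_of_nonneg_left (φ.norm_coe_le_norm t) (norm_nonneg _)

theorem integralMul_apply (ν : Measure Torus) (q : Torus → ℂ) (hq : Integrable q ν)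
    (φ : C(Torus, ℂ)) : integralMul ν q hq φ = ∫ t, φ t * q t ∂ν := rfl

theorem eq_zero_of_apply_fourier (L : C(Torus, ℂ) →L[ℂ] ℂ) (h : ∀ n : ℤ, L (fourier n) = 0) :
    L = 0 := by
  refine ContinuousLinearMap.ext_on (s := Set.range (fourier : ℤ → C(Torus, ℂ))) ?_ ?_
  · exact Submodule.dense_iff_topologicalClosure_eq_top.mpr span_fourier_closure_eq_top
  · rintro _ ⟨n, rfl⟩
    simpa using h n

/-- An integrable function on the circle with vanishing Fourier coefficients is zero. -/
theorem ae_eq_zero_of_fourierCoeff {q : Torus → ℂ} (hq : Integrable q arc)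
    (h : ∀ n : ℤ, fourierCoeff q n = 0) : q =ᵐ[arc] 0 := by
  have hL : integralMul arc q hq = 0 := eq_zero_of_apply_fourier _ fun n => by
    rw [integralMul_apply, ← h (-n), fourierCoeff_eq]
    simp only [neg_neg, fourier_eq_pt]
  -- The integral of `q` over a closed set is a limit of integrals against continuous functions
  -- decreasing to its indicator, and those vanish by density of trigonometric polynomials.
  refine ae_eq_zero_of_forall_setIntegral_isClosed_eq_zero hq fun s hs => ?_
  have hlim : Tendsto (fun n : ℕ => ∫ t, ((hs.apprSeq n t : ℝ) : ℂ) * q t ∂arc) atTop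
      (𝓝 (∫ t, s.indicator q t ∂arc)) := by
    refine tendsto_integral_of_dominated_convergence (fun t => ‖q t‖) (fun n => ?_) hq.norm
      (fun n => ae_of_all _ fun t => ?_) (ae_of_all _ fun t => ?_)
    · refine AEStronglyMeasurable.mul (Continuous.aestronglyMeasurable ?_) hq.1
      have := (hs.apprSeq n).continuous
      fun_prop
    · rw [norm_mul]
      refine mul_le_of_le_one_left (norm_nonneg _) ?_
      have := HasOuterApproxClosed.apprSeq_apply_le_one hs n t
      rw [Complex.norm_real, Real.norm_of_nonneg (NNReal.coe_nonneg _)]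
      exact_mod_cast this
    · have h1 := tendsto_pi_nhds.mp (HasOuterApproxClosed.tendsto_apprSeq hs) t
      have h2 : Tendsto (fun n : ℕ => ((hs.apprSeq n t : ℝ) : ℂ) * q t) atTop
          (𝓝 ((((s.indicator (fun _ => (1 : NNReal)) t : NNReal) : ℝ) : ℂ) * q t)) := by
        refine Tendsto.mul_const _ ?_
        have hc : Continuous fun x : NNReal => ((x : ℝ) : ℂ) := by fun_prop
        exact (hc.tendsto _).comp h1
      convert h2 using 2
      by_cases ht : t ∈ s <;> simp [ht]
  have hzero : ∀ n : ℕ, ∫ t, ((hs.apprSeq n t : ℝ) : ℂ) * q t ∂arc = 0 := fun n => by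
    have hc : Continuous fun t => ((hs.apprSeq n t : ℝ) : ℂ) := by
      have := (hs.apprSeq n).continuous
      fun_prop
    have := integralMul_apply arc q hq ⟨_, hc⟩
    rw [hL] at this
    simpa using this.symm
  simp only [hzero] at hlim
  rw [← integral_indicator hs.measurableSet]
  exact tendsto_nhds_unique hlim tendsto_const_nhds

/-- A finite measure on the circle with the moments of Lebesgue measure is Lebesgue measure. -/
theorem eq_arc_of_moments (ν : Measure Torus) [IsFiniteMeasure ν]
    (h : ∀ n : ℤ, ∫ t, pt t ^ n ∂ν = ∫ t, pt t ^ n ∂arc) : ν = arc := by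
  have hL : integralMul ν (fun _ => 1) (integrable_const _) =
      integralMul arc (fun _ => 1) (integrable_const _) := by
    rw [← sub_eq_zero]
    refine eq_zero_of_apply_fourier _ fun n => ?_
    rw [sub_apply, integralMul_apply, integralMul_apply, sub_eq_zero]
    simpa only [fourier_eq_pt, mul_one] using h n
  refine ext_of_forall_integral_eq_of_IsFiniteMeasure fun f => ?_
  have hf : Continuous fun t => ((f t : ℝ) : ℂ) := by
    have := f.continuous
    fun_prop
  have := congrArg (fun L => L ⟨_, hf⟩) hL
  simp only [integralMul_apply, ContinuousMap.coe_mk, mul_one] at this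
  rw [integral_complex_ofReal, integral_complex_ofReal] at this
  exact_mod_cast this

theorem integral_pt_zpow (n : ℤ) : ∫ t, pt t ^ n ∂arc = if n = 0 then 1 else 0 := by
  have h := fourierCoeff_fourier (T := 2 * Real.pi) 0
  have h1 : fourierCoeff (fourier 0 : Torus → ℂ) (-n) = ∫ t, pt t ^ n ∂arc := by
    rw [fourierCoeff_eq]
    simp
  rw [← h1, h]
  by_cases hn : n = 0
  · simp [hn]
  · simp [hn]

/-! ### Boundary functions of analytic functions -/

/-- `q` is the boundary function of an element of `H²`. -/
def IsHardy (q : Torus → ℂ) : Prop := MemLp q 2 arc ∧ ∀ n : ℤ, n < 0 → fourierCoeff q n = 0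

/-- The Cauchy integral of a function on the circle. -/
def cauchy (q : Torus → ℂ) (z : 𝔻) : ℂ := ∫ t, q t / (1 - conj (pt t) * (z : ℂ)) ∂arc

theorem H2.eval_eq (f : H2) : f.eval = cauchy f.bdry := rfl

theorem isHardy_bdry (f : H2) : IsHardy f.bdry := ⟨Lp.memLp _, f.2⟩

theorem IsHardy.congr {q r : Torus → ℂ} (h : IsHardy q) (e : q =ᵐ[arc] r) : IsHardy r :=
  ⟨(memLp_congr_ae e).mp h.1, fun n hn => by rw [← fourierCoeff_congr_ae e, h.2 n hn]⟩

theorem isHardy_congr {q r : Torus → ℂ} (e : q =ᵐ[arc] r) : IsHardy q ↔ IsHardy r :=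
  ⟨fun h => h.congr e, fun h => h.congr e.symm⟩

theorem cauchy_congr {q r : Torus → ℂ} (e : q =ᵐ[arc] r) : cauchy q = cauchy r := by
  funext z
  refine integral_congr_ae ?_
  filter_upwards [e] with t ht
  rw [ht]

theorem IsHardy.integrable {q : Torus → ℂ} (h : IsHardy q) : Integrable q arc :=
  h.1.integrable (by norm_num)

/-- The element of `H²` with given boundary function. -/
def IsHardy.toH2 {q : Torus → ℂ} (h : IsHardy q) : H2 :=
  ⟨h.1.toLp q, fun n hn => by rw [fourierCoeff_congr_ae h.1.coeFn_toLp, h.2 n hn]⟩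

theorem IsHardy.bdry_toH2 {q : Torus → ℂ} (h : IsHardy q) : h.toH2.bdry =ᵐ[arc] q :=
  h.1.coeFn_toLp

theorem IsHardy.eval_toH2 {q : Torus → ℂ} (h : IsHardy q) : h.toH2.eval = cauchy q :=
  cauchy_congr h.bdry_toH2

theorem H2.ext_bdry {f g : H2} (h : f.bdry =ᵐ[arc] g.bdry) : f = g :=
  Subtype.ext (Lp.ext h)

theorem H2.bdry_add (f g : H2) : (f + g).bdry =ᵐ[arc] fun t => f.bdry t + g.bdry t :=
  Lp.coeFn_add _ _

theorem H2.bdry_smul (c : ℂ) (f : H2) : (c • f).bdry =ᵐ[arc] fun t => c * f.bdry t :=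
  Lp.coeFn_smul _ _

theorem H2.bdry_zero : (0 : H2).bdry =ᵐ[arc] fun _ => 0 := Lp.coeFn_zero ℂ 2 arc

instance H2.instInner : Inner ℂ H2 := InnerProductSpace.toInner

theorem H2.inner_eq (f g : H2) : inner ℂ f g = ∫ t, conj (f.bdry t) * g.bdry t ∂arc := by
  rw [Submodule.coe_inner, L2.inner_def]
  simp only [RCLike.inner_apply, H2.bdry, mul_comm]

/-- The Cauchy kernel is a geometric series in `ζ̄ z`, integrated term by term. Only integrability
is assumed, so that products of two `H²` functions are covered. -/
theorem hasSum_cauchy_int {q : Torus → ℂ} (hq : Integrable q arc) (z : 𝔻) :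
    HasSum (fun n : ℕ => fourierCoeff q n * (z : ℂ) ^ n) (cauchy q z) := by
  have hz := z.norm_lt_one
  have hn : ∀ t, ‖conj (pt t) * (z : ℂ)‖ = ‖(z : ℂ)‖ := fun t => by
    rw [norm_mul, RCLike.norm_conj, norm_pt, one_mul]
  have hint : ∀ n : ℕ, Integrable (fun t => q t * (conj (pt t) * (z : ℂ)) ^ n) arc := fun n => by
    refine hq.mul_bdd (c := 1) (Continuous.aestronglyMeasurable ?_) (ae_of_all _ fun t => ?_)
    · have := continuous_pt
      fun_prop
    · rw [norm_pow, hn]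
      exact pow_le_one₀ (norm_nonneg _) hz.le
  have h := hasSum_integral_of_summable_integral_norm (μ := arc) hint ?_
  · convert! h using 1
    · funext n
      rw [fourierCoeff_eq, ← integral_mul_const]
      refine integral_congr_ae (ae_of_all _ fun t => ?_)
      simp only [mul_pow, conj_pt, zpow_neg, zpow_natCast, inv_pow]
      ring
    · refine integral_congr_ae (ae_of_all _ fun t => ?_)
      simp only
      rw [tsum_mul_left, tsum_geometric_of_norm_lt_one (by rw [hn]; exact hz), div_eq_mul_inv]
  · have : ∀ n : ℕ, ∫ t, ‖q t * (conj (pt t) * (z : ℂ)) ^ n‖ ∂arc =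
        (∫ t, ‖q t‖ ∂arc) * ‖(z : ℂ)‖ ^ n := fun n => by
      rw [← integral_mul_const]
      simp only [norm_mul, norm_pow, RCLike.norm_conj, norm_pt, one_mul]
    simp only [this]
    exact (summable_geometric_of_lt_one (norm_nonneg _) hz).mul_left _

theorem norm_fourierCoeff_le {q : Torus → ℂ} (n : ℤ) :
    ‖fourierCoeff q n‖ ≤ ∫ t, ‖q t‖ ∂arc := by
  rw [fourierCoeff_eq]
  refine (norm_integral_le_integral_norm _).trans (le_of_eq ?_)
  simp

/-- Uniqueness of the coefficients of a power series on the disc. -/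
theorem coeff_eq_of_hasSum {a b : ℕ → ℂ} {F : 𝔻 → ℂ}
    (ha : ∀ z : 𝔻, HasSum (fun n => a n * (z : ℂ) ^ n) (F z))
    (hb : ∀ z : 𝔻, HasSum (fun n => b n * (z : ℂ) ^ n) (F z)) : a = b := by
  -- Extension by zero to the whole plane; only its values on the ball of radius 1/2 matter, and
  -- convergence at the point 1/2 bounds the radius from below.
  let G : ℂ → ℂ := fun z => if h : ‖z‖ < 1 then F (UnitDisc.mk z h) else 0
  have key : ∀ c : ℕ → ℂ, (∀ z : 𝔻, HasSum (fun n => c n * (z : ℂ) ^ n) (F z)) →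
      HasFPowerSeriesOnBall G (FormalMultilinearSeries.ofScalars ℂ c) 0 (ENNReal.ofReal (1 / 2)) := by
    intro c hc
    refine ⟨?_, by simp, fun {y} hy => ?_⟩
    · have := (hc (UnitDisc.mk (1 / 2) (by norm_num))).summable
      have h2 := this.tendsto_atTop_zero.norm
      refine (FormalMultilinearSeries.le_radius_of_tendsto (r := 1 / 2) _ (l := 0) ?_).trans' ?_
      · convert h2 using 2 with n
        · simp
        · simp
      · simp
    · have hy' : ‖y‖ < 1 := by
        rw [Metric.eball_ofReal, mem_ball_zero_iff] at hy
        linarith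
      have := hc (UnitDisc.mk y hy')
      simpa [G, hy', FormalMultilinearSeries.ofScalars_apply_eq, smul_eq_mul, mul_comm] using this
  have := (key a ha).hasFPowerSeriesAt.eq_formalMultilinearSeries (key b hb).hasFPowerSeriesAt
  exact FormalMultilinearSeries.ofScalars_series_injective ℂ ℂ this

theorem fourierCoeff_eq_of_cauchy_eq {q r : Torus → ℂ} (hq : Integrable q arc)
    (hr : Integrable r arc) (h : cauchy q = cauchy r) (n : ℕ) :
    fourierCoeff q n = fourierCoeff r n := by
  refine congrFun (coeff_eq_of_hasSum (hasSum_cauchy_int hq) (b := fun n => fourierCoeff r n) ?_) n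
  rw [h]
  exact hasSum_cauchy_int hr

/-- Functions with Fourier coefficients supported on `ℕ` are determined by their Cauchy integral. -/
theorem ae_eq_of_cauchy_eq {q r : Torus → ℂ} (hq : Integrable q arc) (hr : Integrable r arc)
    (hq0 : ∀ n : ℤ, n < 0 → fourierCoeff q n = 0) (hr0 : ∀ n : ℤ, n < 0 → fourierCoeff r n = 0)
    (h : cauchy q = cauchy r) : q =ᵐ[arc] r := by
  have : (fun t => q t - r t) =ᵐ[arc] 0 := by
    refine ae_eq_zero_of_fourierCoeff (hq.sub hr) fun n => ?_
    have hs : fourierCoeff (fun t => q t - r t) n = fourierCoeff q n - fourierCoeff r n := by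
      simp only [fourierCoeff, smul_sub]
      exact integral_sub (hq.fourier_smul _) (hr.fourier_smul _)
    rw [hs, sub_eq_zero]
    rcases lt_or_ge n 0 with hn | hn
    · rw [hq0 n hn, hr0 n hn]
    · lift n to ℕ using hn
      exact fourierCoeff_eq_of_cauchy_eq hq hr h n
  filter_upwards [this] with t ht
  exact sub_eq_zero.mp ht

theorem IsHardy.ae_eq_of_cauchy_eq {q r : Torus → ℂ} (hq : IsHardy q) (hr : IsHardy r)
    (h : cauchy q = cauchy r) : q =ᵐ[arc] r :=
  HardyDisc.ae_eq_of_cauchy_eq hq.integrable hr.integrable hq.2 hr.2 h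

theorem H2.eval_injective : Function.Injective H2.eval := fun f g h =>
  H2.ext_bdry ((isHardy_bdry f).ae_eq_of_cauchy_eq (isHardy_bdry g) h)

/-! ### Fourier coefficients and Cauchy integrals of products -/

theorem fourierCoeff_zpow_mul (m : ℤ) (q : Torus → ℂ) (n : ℤ) :
    fourierCoeff (fun t => pt t ^ m * q t) n = fourierCoeff q (n - m) := by
  rw [fourierCoeff_eq, fourierCoeff_eq]
  refine integral_congr_ae (ae_of_all _ fun t => ?_)
  simp only
  rw [← mul_assoc, ← zpow_add₀ (pt_ne_zero t)]
  congr 2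
  ring

theorem fourierCoeff_conj (q : Torus → ℂ) (n : ℤ) :
    fourierCoeff (fun t => conj (q t)) n = conj (fourierCoeff q (-n)) := by
  rw [fourierCoeff_eq, fourierCoeff_eq, ← integral_conj]
  refine integral_congr_ae (ae_of_all _ fun t => ?_)
  simp [conj_pt]

theorem fourierCoeff_zpow (m n : ℤ) :
    fourierCoeff (fun t => pt t ^ m) n = if n = m then 1 else 0 := by
  rw [fourierCoeff_eq]
  simp only [← zpow_add₀ (pt_ne_zero _)]
  rw [integral_pt_zpow]
  congr 1
  rw [eq_iff_iff]
  constructor <;> intro h <;> linarith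

theorem inner_fourierBasis (n : ℤ) (g : Lp ℂ 2 arc) :
    inner ℂ (fourierBasis n) g = fourierCoeff (g : Torus → ℂ) n := by
  rw [← fourierBasis_repr, HilbertBasis.repr_apply_apply]

/-- Parseval's identity. -/
theorem hasSum_integral_mul {f g : Torus → ℂ} (hf : MemLp f 2 arc) (hg : MemLp g 2 arc) :
    HasSum (fun k : ℤ => fourierCoeff f (-k) * fourierCoeff g k) (∫ t, f t * g t ∂arc) := by
  have hf' : MemLp (fun t => conj (f t)) 2 arc := hf.star
  have h := fourierBasis.hasSum_inner_mul_inner hf'.toLp hg.toLp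
  convert! h using 1
  · funext k
    rw [← inner_conj_symm, inner_fourierBasis, inner_fourierBasis,
      fourierCoeff_congr_ae hf'.coeFn_toLp, fourierCoeff_congr_ae hg.coeFn_toLp, fourierCoeff_conj]
    simp
  · rw [L2.inner_def]
    refine integral_congr_ae ?_
    filter_upwards [hf'.coeFn_toLp, hg.coeFn_toLp] with t h1 h2
    rw [RCLike.inner_apply, h1, h2]
    simp [mul_comm]

theorem memLp_zpow_mul (m : ℤ) {f : Torus → ℂ} {p : ℝ≥0∞} (hf : MemLp f p arc) :
    MemLp (fun t => pt t ^ m * f t) p arc := by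
  refine hf.of_le (AEStronglyMeasurable.mul (Continuous.aestronglyMeasurable ?_) hf.1)
    (ae_of_all _ fun t => ?_)
  · exact continuous_pt.zpow₀ m fun t => Or.inl (pt_ne_zero t)
  · simp

theorem hasSum_fourierCoeff_mul {f g : Torus → ℂ} (hf : MemLp f 2 arc) (hg : MemLp g 2 arc)
    (n : ℤ) : HasSum (fun k : ℤ => fourierCoeff f (n - k) * fourierCoeff g k)
      (fourierCoeff (fun t => f t * g t) n) := by
  convert! hasSum_integral_mul (memLp_zpow_mul (-n) hf) hg using 1
  · funext k
    rw [fourierCoeff_zpow_mul]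
    congr 2
    ring
  · rw [fourierCoeff_eq]
    simp only [mul_assoc]

/-- In the convolution sum, `k` and `n - k` cannot both be nonnegative when `n < 0`, so each term
has a zero factor. -/
theorem IsHardy.fourierCoeff_mul_neg {f g : Torus → ℂ} (hf : IsHardy f) (hg : IsHardy g)
    {n : ℤ} (hn : n < 0) : fourierCoeff (fun t => f t * g t) n = 0 := by
  refine (hasSum_fourierCoeff_mul hf.1 hg.1 n).unique ?_
  convert hasSum_zero with k
  rcases lt_or_ge k 0 with hk | hk
  · rw [hg.2 k hk, mul_zero]
  · rw [hf.2 _ (by linarith), zero_mul]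

theorem IsHardy.fourierCoeff_mul {f g : Torus → ℂ} (hf : IsHardy f) (hg : IsHardy g) (n : ℕ) :
    fourierCoeff (fun t => f t * g t) n =
      ∑ k ∈ Finset.range (n + 1), fourierCoeff f k * fourierCoeff g ((n - k : ℕ) : ℤ) := by
  refine (hasSum_fourierCoeff_mul hf.1 hg.1 n).unique ?_
  rw [← Finset.sum_range_reflect]
  have hinj : Function.Injective ((↑) : ℕ → ℤ) := Nat.cast_injective
  rw [← hinj.hasSum_iff]
  · convert hasSum_sum_of_ne_finset_zero (s := Finset.range (n + 1)) ?_ using 1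
    · refine Finset.sum_congr rfl fun k hk => ?_
      have hk' : k ≤ n := Nat.lt_succ_iff.mp (Finset.mem_range.mp hk)
      simp only [Function.comp]
      congr 2
      · omega
      · omega
    · intro k hk
      simp only [Finset.mem_range, not_lt] at hk
      simp only [Function.comp]
      rw [hf.2 _ (by omega), zero_mul]
    · infer_instance
  · intro k hk
    rw [hg.2 k, mul_zero]
    by_contra h
    exact hk ⟨k.toNat, by omega⟩

theorem IsHardy.integrable_mul {f g : Torus → ℂ} (hf : IsHardy f) (hg : IsHardy g) :
    Integrable (fun t => f t * g t) arc := hf.1.integrable_mul hg.1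

theorem summable_norm_fourierCoeff {q : Torus → ℂ} (z : 𝔻) :
    Summable fun n : ℕ => ‖fourierCoeff q n * (z : ℂ) ^ n‖ := by
  refine Summable.of_nonneg_of_le (fun _ => norm_nonneg _) (fun n => ?_)
    ((summable_geometric_of_lt_one (norm_nonneg _) z.norm_lt_one).mul_left (∫ t, ‖q t‖ ∂arc))
  rw [norm_mul, norm_pow]
  exact mul_le_mul_of_nonneg_right (norm_fourierCoeff_le _) (by positivity)

/-- The Cauchy integral is multiplicative on boundary functions of analytic functions. -/
theorem IsHardy.cauchy_mul {f g : Torus → ℂ} (hf : IsHardy f) (hg : IsHardy g) :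
    cauchy (fun t => f t * g t) = cauchy f * cauchy g := by
  funext z
  rw [Pi.mul_apply, ← (hasSum_cauchy_int hf.integrable z).tsum_eq,
    ← (hasSum_cauchy_int hg.integrable z).tsum_eq,
    tsum_mul_tsum_eq_tsum_sum_range_of_summable_norm (summable_norm_fourierCoeff z)
      (summable_norm_fourierCoeff z), ← (hasSum_cauchy_int (hf.integrable_mul hg) z).tsum_eq]
  congr 1
  funext n
  rw [hf.fourierCoeff_mul hg, Finset.sum_mul]
  refine Finset.sum_congr rfl fun k hk => ?_
  have hk' : k ≤ n := Nat.lt_succ_iff.mp (Finset.mem_range.mp hk)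
  have : (z : ℂ) ^ n = z ^ k * z ^ (n - k) := by rw [← pow_add, Nat.add_sub_cancel' hk']
  rw [this]
  ring

theorem memLp_bdd_mul {f g : Torus → ℂ} {C : ℝ} (hf : AEStronglyMeasurable f arc)
    (hb : ∀ᵐ t ∂arc, ‖f t‖ ≤ C) (hg : MemLp g 2 arc) : MemLp (fun t => f t * g t) 2 arc :=
  hg.of_le_mul (c := C) (hf.mul hg.1) (by
    filter_upwards [hb] with t ht
    rw [norm_mul]
    exact mul_le_mul_of_nonneg_right ht (norm_nonneg _))

theorem IsHardy.bdd_mul {f g : Torus → ℂ} {C : ℝ} (hf : IsHardy f)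
    (hb : ∀ᵐ t ∂arc, ‖f t‖ ≤ C) (hg : IsHardy g) : IsHardy fun t => f t * g t :=
  ⟨memLp_bdd_mul hf.1.1 hb hg.1, fun _ => hf.fourierCoeff_mul_neg hg⟩

theorem IsHardy.add {f g : Torus → ℂ} (hf : IsHardy f) (hg : IsHardy g) :
    IsHardy fun t => f t + g t :=
  ⟨hf.1.add hg.1, fun n hn => by
    have h := congrFun (fourierCoeff.add hf.integrable hg.integrable) n
    rw [Pi.add_apply, hf.2 n hn, hg.2 n hn, add_zero] at h
    exact h⟩

theorem IsHardy.const_mul {f : Torus → ℂ} (hf : IsHardy f) (c : ℂ) : IsHardy fun t => c * f t :=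
  ⟨hf.1.const_mul c, fun n hn => by rw [fourierCoeff.const_mul, hf.2 n hn, mul_zero]⟩

theorem IsHardy.sub {f g : Torus → ℂ} (hf : IsHardy f) (hg : IsHardy g) :
    IsHardy fun t => f t - g t := by
  have h := hf.add (hg.const_mul (-1))
  simpa only [neg_one_mul, ← sub_eq_add_neg] using h

theorem cauchy_const_mul (f : Torus → ℂ) (c : ℂ) (z : 𝔻) :
    cauchy (fun t => c * f t) z = c * cauchy f z := by
  simp only [cauchy, mul_div_assoc]
  exact integral_const_mul _ _

theorem cauchy_add {f g : Torus → ℂ} (hf : Integrable f arc) (hg : Integrable g arc) (z : 𝔻) :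
    cauchy (fun t => f t + g t) z = cauchy f z + cauchy g z := by
  refine (hasSum_cauchy_int (hf.add hg) z).unique ?_
  convert! (hasSum_cauchy_int hf z).add (hasSum_cauchy_int hg z) using 1
  funext n
  rw [fourierCoeff.add hf hg, Pi.add_apply, add_mul]

theorem cauchy_sub {f g : Torus → ℂ} (hf : Integrable f arc) (hg : Integrable g arc) (z : 𝔻) :
    cauchy (fun t => f t - g t) z = cauchy f z - cauchy g z := by
  have h := cauchy_add hf (hg.const_mul (-1)) z
  rw [cauchy_const_mul] at h
  simpa only [neg_one_mul, ← sub_eq_add_neg] using h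

theorem isHardy_pow (n : ℕ) : IsHardy fun t => pt t ^ n := by
  refine ⟨MemLp.of_bound (Continuous.aestronglyMeasurable (continuous_pt.pow n)) 1
    (ae_of_all _ fun t => by simp), fun m hm => ?_⟩
  have := fourierCoeff_zpow n m
  simp only [zpow_natCast] at this
  rw [this, if_neg (by omega)]

theorem cauchy_zpow (m : ℤ) (z : 𝔻) :
    cauchy (fun t => pt t ^ m) z = if m < 0 then 0 else (z : ℂ) ^ m := by
  have hint : Integrable (fun t => pt t ^ m) arc := by
    refine Integrable.of_bound (C := 1) (Continuous.aestronglyMeasurable ?_)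
      (ae_of_all _ fun t => by simp)
    exact continuous_pt.zpow₀ m fun t => Or.inl (pt_ne_zero t)
  refine (hasSum_cauchy_int hint z).unique ?_
  simp only [fourierCoeff_zpow]
  split_ifs with hm
  · convert hasSum_zero with n
    rw [if_neg (by omega), zero_mul]
  · lift m to ℕ using by omega
    convert! hasSum_ite_eq m ((z : ℂ) ^ m) using 1
    funext n
    by_cases h : n = m <;> simp [h]

theorem cauchy_pow (n : ℕ) (z : 𝔻) : cauchy (fun t => pt t ^ n) z = (z : ℂ) ^ n := by
  have := cauchy_zpow n z
  rw [if_neg (by omega)] at this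
  simpa using this

theorem isHardy_pt : IsHardy pt := by simpa using isHardy_pow 1

theorem cauchy_pt (z : 𝔻) : cauchy pt z = z := by simpa using cauchy_pow 1 z

theorem isHardy_const (c : ℂ) : IsHardy fun _ => c := by
  simpa using (isHardy_pow 0).const_mul c

theorem cauchy_const (c : ℂ) (z : 𝔻) : cauchy (fun _ => c) z = c := by
  have := cauchy_const_mul (fun t => pt t ^ 0) c z
  rw [cauchy_pow] at this
  simpa using this

/-- The Cauchy kernel `1 / (1 - ā ζ)`. -/
def szego (a : 𝔻) (t : Torus) : ℂ := (1 - conj (a : ℂ) * pt t)⁻¹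

theorem szego_ne (a : 𝔻) (t : Torus) : 1 - conj (a : ℂ) * pt t ≠ 0 :=
  one_sub_ne_zero a (norm_pt t).le

theorem continuous_szego (a : 𝔻) : Continuous (szego a) :=
  (continuous_const.sub (continuous_const.mul continuous_pt)).inv₀ (szego_ne a)

theorem norm_szego_le (a : 𝔻) (t : Torus) : ‖szego a t‖ ≤ (1 - ‖(a : ℂ)‖)⁻¹ := by
  rw [szego, norm_inv]
  refine inv_anti₀ (by linarith [a.norm_lt_one]) ?_
  have := norm_sub_norm_le 1 (conj (a : ℂ) * pt t)
  rwa [norm_mul, RCLike.norm_conj, norm_pt, norm_one, mul_one] at this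

/-- Conjugation turns this coefficient into the Cauchy integral of `ζⁿ` at `a`, already computed. -/
theorem fourierCoeff_szego (a : 𝔻) (n : ℤ) :
    fourierCoeff (szego a) n = if n < 0 then 0 else conj (a : ℂ) ^ n := by
  have h := congrArg conj (cauchy_zpow n a)
  rw [cauchy, ← integral_conj] at h
  rw [fourierCoeff_eq]
  convert h using 1
  · refine integral_congr_ae (ae_of_all _ fun t => ?_)
    simp [szego, conj_pt, div_eq_mul_inv, mul_comm]
  · split_ifs <;> simp

theorem isHardy_szego (a : 𝔻) : IsHardy (szego a) :=
  ⟨MemLp.of_bound (continuous_szego a).aestronglyMeasurable _ (ae_of_all _ (norm_szego_le a)),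
    fun n hn => by rw [fourierCoeff_szego, if_pos hn]⟩

theorem cauchy_szego (a z : 𝔻) : cauchy (szego a) z = (1 - conj (a : ℂ) * (z : ℂ))⁻¹ := by
  refine (hasSum_cauchy_int (isHardy_szego a).integrable z).unique ?_
  convert! hasSum_geometric_of_norm_lt_one (ξ := conj (a : ℂ) * (z : ℂ)) ?_ using 1
  · funext n
    rw [fourierCoeff_szego, if_neg (by omega), mul_pow, zpow_natCast]
  · rw [norm_mul, RCLike.norm_conj]
    exact mul_lt_one_of_nonneg_of_lt_one_left (norm_nonneg _) a.norm_lt_one z.norm_lt_one.le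

/-! ### Disc automorphisms -/

theorem coe_aut (lam : Circle) (a z : 𝔻) :
    (aut lam a z : ℂ) = (lam : ℂ) * (((a : ℂ) - z) / (1 - conj (a : ℂ) * z)) := rfl

theorem autBdry_apply (lam : Circle) (a : 𝔻) (t : Torus) :
    autBdry lam a t = (lam : ℂ) * (((a : ℂ) - pt t) / (1 - conj (a : ℂ) * pt t)) := rfl

theorem autBdry_eq_szego (lam : Circle) (a : 𝔻) (t : Torus) :
    autBdry lam a t = (lam : ℂ) * (((a : ℂ) - pt t) * szego a t) := rfl

theorem aut_self (lam : Circle) (a : 𝔻) : aut lam a a = 0 := by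
  rw [← UnitDisc.coe_inj, coe_aut]
  simp

theorem conj_szego_ne (a : 𝔻) (t : Torus) : 1 - (a : ℂ) * (pt t)⁻¹ ≠ 0 := by
  have h := (map_ne_zero (starRingEnd ℂ)).mpr (szego_ne a t)
  simpa [conj_pt] using h

theorem autBdry_div_pt (lam : Circle) (a : 𝔻) (t : Torus) :
    autBdry lam a t * (pt t)⁻¹ = -(lam : ℂ) * (1 - a * (pt t)⁻¹) * szego a t := by
  have := pt_ne_zero t
  rw [autBdry_eq_szego]
  field_simp
  ring

@[simp]
theorem norm_autBdry (lam : Circle) (a : 𝔻) (t : Torus) : ‖autBdry lam a t‖ = 1 := by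
  have h := congrArg norm (autBdry_div_pt lam a t)
  have h2 : ‖1 - (a : ℂ) * (pt t)⁻¹‖ = ‖1 - conj (a : ℂ) * pt t‖ := by
    rw [← RCLike.norm_conj]
    simp [conj_pt]
  have h3 : ‖1 - conj (a : ℂ) * pt t‖ ≠ 0 := norm_ne_zero_iff.mpr (szego_ne a t)
  have h4 : ‖autBdry lam a t‖ = ‖(lam : ℂ)‖ := by simpa [h2, szego, h3] using h
  exact h4.trans (Circle.norm_coe lam)

theorem autBdry_ne_zero (lam : Circle) (a : 𝔻) (t : Torus) : autBdry lam a t ≠ 0 := by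
  rw [← norm_ne_zero_iff, norm_autBdry]
  exact one_ne_zero

theorem conj_autBdry (lam : Circle) (a : 𝔻) (t : Torus) :
    conj (autBdry lam a t) = (autBdry lam a t)⁻¹ := by
  rw [Complex.inv_def, Complex.normSq_eq_norm_sq, norm_autBdry]
  simp

theorem isHardy_autBdry (lam : Circle) (a : 𝔻) : IsHardy (autBdry lam a) :=
  ((isHardy_szego a).bdd_mul (ae_of_all _ (norm_szego_le a))
    ((isHardy_const (a : ℂ)).sub isHardy_pt)).const_mul lam |>.congr
      (ae_of_all _ fun t => by simp only [autBdry_eq_szego, mul_comm])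

theorem cauchy_autBdry (lam : Circle) (a z : 𝔻) : cauchy (autBdry lam a) z = aut lam a z := by
  have h := congrFun ((isHardy_szego a).cauchy_mul ((isHardy_const (a : ℂ)).sub isHardy_pt)) z
  rw [Pi.mul_apply, cauchy_sub (isHardy_const _).integrable isHardy_pt.integrable, cauchy_const,
    cauchy_pt, cauchy_szego] at h
  have h2 : (autBdry lam a : Torus → ℂ) = fun t => (lam : ℂ) * (szego a t * ((a : ℂ) - pt t)) := by
    funext t
    rw [autBdry_eq_szego, mul_comm (szego a t)]
  rw [h2, cauchy_const_mul, h, coe_aut, div_eq_mul_inv, mul_comm (_ - _)]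

theorem isHardy_autBdry_pow (lam : Circle) (a : 𝔻) (n : ℕ) :
    IsHardy fun t => autBdry lam a t ^ n := by
  induction n with
  | zero => simpa using isHardy_const 1
  | succ n ih =>
    simp only [pow_succ']
    exact (isHardy_autBdry lam a).bdd_mul (C := 1) (ae_of_all _ fun t => by simp) ih

theorem cauchy_autBdry_pow (lam : Circle) (a z : 𝔻) (n : ℕ) :
    cauchy (fun t => autBdry lam a t ^ n) z = (aut lam a z : ℂ) ^ n := by
  induction n with
  | zero => simpa using cauchy_const 1 z
  | succ n ih =>
    simp only [pow_succ']
    rw [(isHardy_autBdry lam a).cauchy_mul (isHardy_autBdry_pow lam a n), Pi.mul_apply, ih,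
      cauchy_autBdry]

/-- The inverse of `ψ` is the automorphism with constant `λ⁻¹` and zero `ψ(0) = λ a`. The identity
is stated for a complex number `w` so that it serves both the disc and the circle. -/
theorem aut_comp (lam : Circle) (a : 𝔻) (w : ℂ) (hw : 1 - conj (a : ℂ) * w ≠ 0)
    (hw' : 1 - conj ((lam • a : 𝔻) : ℂ) *
      ((lam : ℂ) * (((a : ℂ) - w) / (1 - conj (a : ℂ) * w))) ≠ 0) :
    ((lam⁻¹ : Circle) : ℂ) * ((((lam • a : 𝔻) : ℂ) -
      (lam : ℂ) * (((a : ℂ) - w) / (1 - conj (a : ℂ) * w))) /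
      (1 - conj ((lam • a : 𝔻) : ℂ) *
        ((lam : ℂ) * (((a : ℂ) - w) / (1 - conj (a : ℂ) * w))))) = w := by
  have hl : (lam : ℂ) ≠ 0 := Circle.coe_ne_zero _
  have hc : conj (lam : ℂ) = (lam : ℂ)⁻¹ := by rw [← Circle.coe_inv, Circle.coe_inv_eq_conj]
  rw [UnitDisc.coe_circle_smul, map_mul, hc] at hw' ⊢
  rw [Circle.coe_inv, ← mul_div_assoc, div_eq_iff hw']
  clear hw' hc
  generalize (lam : ℂ) = l at *
  generalize conj (a : ℂ) = b at *
  generalize (a : ℂ) = c at *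
  have e : (c - w) / (1 - b * w) * (1 - b * w) = c - w := div_mul_cancel₀ _ hw
  generalize (c - w) / (1 - b * w) = r at *
  field_simp
  linear_combination -e

theorem aut_aut (lam : Circle) (a z : 𝔻) : aut lam⁻¹ (lam • a) (aut lam a z) = z := by
  rw [← UnitDisc.coe_inj, coe_aut, coe_aut]
  refine aut_comp lam a z (one_sub_ne_zero a z.norm_lt_one.le) ?_
  exact one_sub_ne_zero _ (aut lam a z).norm_lt_one.le

theorem aut_aut' (lam : Circle) (a z : 𝔻) : aut lam a (aut lam⁻¹ (lam • a) z) = z := by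
  have := aut_aut lam⁻¹ (lam • a) z
  rwa [inv_inv, inv_smul_smul] at this

/-- The automorphism `ψ` of the circle, in terms of angles. -/
def autTorus (lam : Circle) (a : 𝔻) (t : Torus) : Torus :=
  (AddCircle.homeomorphCircle Real.two_pi_pos.ne').symm
    ⟨autBdry lam a t, mem_sphere_zero_iff_norm.mpr (norm_autBdry lam a t)⟩

@[simp]
theorem pt_autTorus (lam : Circle) (a : 𝔻) (t : Torus) :
    pt (autTorus lam a t) = autBdry lam a t := by
  rw [pt, ← AddCircle.homeomorphCircle_apply Real.two_pi_pos.ne', autTorus]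
  exact congrArg Subtype.val (Homeomorph.apply_symm_apply
    (AddCircle.homeomorphCircle Real.two_pi_pos.ne') _)

theorem pt_injective : Function.Injective pt :=
  Subtype.val_injective.comp (AddCircle.injective_toCircle Real.two_pi_pos.ne')

theorem continuous_autTorus (lam : Circle) (a : 𝔻) : Continuous (autTorus lam a) :=
  (Homeomorph.continuous _).comp ((autBdry lam a).continuous.subtype_mk _)

theorem autTorus_autTorus (lam : Circle) (a : 𝔻) (t : Torus) :
    autTorus lam⁻¹ (lam • a) (autTorus lam a t) = t := by
  apply pt_injective
  rw [pt_autTorus, autBdry_apply, pt_autTorus, autBdry_apply]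
  refine aut_comp lam a _ (szego_ne a t) ?_
  refine one_sub_ne_zero _ (norm_autBdry lam a t).le

/-- The density of the harmonic measure at `a`. -/
def poisson (a : 𝔻) (t : Torus) : NNReal :=
  Real.toNNReal ((1 - ‖(a : ℂ)‖ ^ 2) / ‖1 - conj (a : ℂ) * pt t‖ ^ 2)

theorem poisson_real (a : 𝔻) (t : Torus) :
    (poisson a t : ℝ) = (1 - ‖(a : ℂ)‖ ^ 2) / ‖1 - conj (a : ℂ) * pt t‖ ^ 2 :=
  Real.coe_toNNReal _ (div_nonneg (by linarith [a.sq_norm_lt_one]) (by positivity))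

/-- The Poisson kernel is `2 Re k - 1` for the Cauchy kernel `k`; this splitting reduces Poisson
integrals to Cauchy integrals. -/
theorem poisson_complex (a : 𝔻) (t : Torus) :
    ((poisson a t : ℝ) : ℂ) = szego a t + conj (szego a t) - 1 := by
  have h1 := szego_ne a t
  have h2 := conj_szego_ne a t
  have hp := pt_ne_zero t
  have h4 : pt t - a ≠ 0 := by
    intro h
    apply h2
    rw [sub_eq_zero.mp h, mul_inv_cancel₀, sub_self]
    rwa [← sub_eq_zero.mp h]
  rw [poisson_real]
  push_cast
  rw [← Complex.mul_conj', ← Complex.mul_conj', szego]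
  simp only [map_sub, map_mul, map_one, Complex.conj_conj, map_inv₀, conj_pt]
  field_simp
  ring

theorem continuous_poisson (a : 𝔻) : Continuous (poisson a) := by
  have h := continuous_pt
  refine continuous_real_toNNReal.comp (Continuous.div (by fun_prop) (by fun_prop) fun t => ?_)
  exact pow_ne_zero _ (norm_ne_zero_iff.mpr (szego_ne a t))

theorem poisson_pos (a : 𝔻) (t : Torus) : 0 < (poisson a t : ℝ) := by
  rw [poisson_real]
  exact div_pos (by linarith [a.sq_norm_lt_one])
    (pow_pos (norm_pos_iff.mpr (szego_ne a t)) 2)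

theorem cauchy_zero (q : Torus → ℂ) : cauchy q 0 = ∫ t, q t ∂arc := by simp [cauchy]

/-- The Poisson formula for boundary functions of analytic functions. -/
theorem IsHardy.integral_mul_poisson {h : Torus → ℂ} (hh : IsHardy h) (a : 𝔻) :
    ∫ t, h t * ((poisson a t : ℝ) : ℂ) ∂arc = cauchy h a := by
  have i1 : Integrable (fun t => szego a t * h t) arc := (isHardy_szego a).integrable_mul hh
  have i2 : Integrable (fun t => conj (szego a t) * h t) arc :=
    (isHardy_szego a).1.star.integrable_mul hh.1
  have e : ∀ t, h t * ((poisson a t : ℝ) : ℂ) =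
      szego a t * h t + conj (szego a t) * h t - h t := fun t => by
    rw [poisson_complex]
    ring
  have s : ∫ t, (szego a t * h t + conj (szego a t) * h t - h t) ∂arc =
      ∫ t, szego a t * h t ∂arc + ∫ t, conj (szego a t) * h t ∂arc - ∫ t, h t ∂arc := by
    rw [← integral_add i1 i2]
    exact integral_sub (i1.add i2) hh.integrable
  simp only [e]
  -- The term with `k h` integrates to `k(0) h(0) = h(0)`, which cancels the last term; the term
  -- with `k̄ h` is the Cauchy integral at `a`.
  rw [s, ← cauchy_zero, ← cauchy_zero h,
    (isHardy_szego a).cauchy_mul hh, Pi.mul_apply, cauchy_szego]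
  simp only [UnitDisc.coe_zero, mul_zero, sub_zero, inv_one, one_mul, add_sub_cancel_left, cauchy]
  refine integral_congr_ae (ae_of_all _ fun t => ?_)
  simp [szego, div_eq_mul_inv, mul_comm]

/-- Harmonic measure at `a`. -/
def harmonicMeasure (a : 𝔻) : Measure Torus := arc.withDensity fun t => (poisson a t : ℝ≥0∞)

theorem integral_harmonicMeasure (a : 𝔻) (g : Torus → ℂ) :
    ∫ t, g t ∂harmonicMeasure a = ∫ t, g t * ((poisson a t : ℝ) : ℂ) ∂arc := by
  rw [harmonicMeasure, integral_withDensity_eq_integral_smul (continuous_poisson a).measurable]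
  refine integral_congr_ae (ae_of_all _ fun t => ?_)
  simp only [NNReal.smul_def, Complex.real_smul, mul_comm]

instance isFiniteMeasure_harmonicMeasure (a : 𝔻) : IsFiniteMeasure (harmonicMeasure a) := by
  obtain ⟨C, hC⟩ := (isCompact_univ (X := Torus)).exists_bound_of_continuousOn
    (NNReal.continuous_coe.comp (continuous_poisson a)).continuousOn
  refine isFiniteMeasure_withDensity (ne_of_lt (lt_of_le_of_lt
    (lintegral_mono (g := fun _ => ENNReal.ofReal C) fun t => ?_) ?_))
  · rw [← ENNReal.ofReal_coe_nnreal]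
    exact ENNReal.ofReal_le_ofReal ((le_abs_self _).trans (hC t (Set.mem_univ t)))
  · simp

/-- The Poisson kernel is at least `(1 - |a|²) / 4`, since `|1 - ā ζ| ≤ 2`. This domination makes
composition with `ψ` preserve `L²` and almost everywhere statements. -/
theorem arc_le_harmonicMeasure (a : 𝔻) :
    arc ≤ ENNReal.ofReal (4 / (1 - ‖(a : ℂ)‖ ^ 2)) • harmonicMeasure a := by
  have ha : 0 < 1 - ‖(a : ℂ)‖ ^ 2 := by linarith [a.sq_norm_lt_one]
  rw [harmonicMeasure, ← withDensity_smul _ (continuous_poisson a).measurable.coe_nnreal_ennreal]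
  conv_lhs => rw [← withDensity_one (μ := arc)]
  refine withDensity_mono (ae_of_all _ fun t => ?_)
  simp only [Pi.one_apply, Pi.smul_apply, smul_eq_mul]
  rw [← ENNReal.ofReal_coe_nnreal, ← ENNReal.ofReal_mul (by positivity), ← ENNReal.ofReal_one]
  refine ENNReal.ofReal_le_ofReal ?_
  have h2 : 0 < ‖1 - conj (a : ℂ) * pt t‖ := norm_pos_iff.mpr (szego_ne a t)
  have h3 : ‖1 - conj (a : ℂ) * pt t‖ ≤ 2 := by
    refine (norm_sub_le _ _).trans ?_
    rw [norm_mul, RCLike.norm_conj, norm_pt, norm_one]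
    linarith [a.norm_lt_one]
  rw [poisson_real, div_mul_div_comm, one_le_div (by positivity)]
  nlinarith [mul_le_mul_of_nonneg_left (pow_le_pow_left₀ h2.le h3 2) ha.le]

theorem arc_ac_harmonicMeasure (a : 𝔻) : arc ≪ harmonicMeasure a :=
  (Measure.absolutelyContinuous_of_le_smul (arc_le_harmonicMeasure a))

/-- The moments agree: by the Poisson formula `ψⁿ` integrates against harmonic measure at `a` to
`ψ(a)ⁿ`, which is 0 for `n > 0`. Conjugation gives the negative moments. -/
theorem measurePreserving_autTorus (lam : Circle) (a : 𝔻) :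
    MeasurePreserving (autTorus lam a) (harmonicMeasure a) arc := by
  refine ⟨(continuous_autTorus lam a).measurable, ?_⟩
  have key : ∀ n : ℕ, ∫ t, autBdry lam a t ^ n ∂harmonicMeasure a = ∫ t, pt t ^ n ∂arc := fun n => by
    rw [integral_harmonicMeasure, (isHardy_autBdry_pow lam a n).integral_mul_poisson,
      cauchy_autBdry_pow, aut_self]
    have := integral_pt_zpow n
    simp only [zpow_natCast] at this
    rw [this]
    by_cases h : n = 0 <;> simp [h]
  refine eq_arc_of_moments _ fun n => ?_
  rw [integral_map (continuous_autTorus lam a).aemeasurable (Continuous.aestronglyMeasurable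
    (continuous_pt.zpow₀ n fun t => Or.inl (pt_ne_zero t)))]
  simp only [pt_autTorus]
  obtain ⟨m, rfl | rfl⟩ := n.eq_nat_or_neg
  · simpa using key m
  · have h := congrArg conj (key m)
    rw [← integral_conj, ← integral_conj] at h
    simpa [conj_pt, conj_autBdry] using h

theorem ae_comp_autTorus (lam : Circle) (a : 𝔻) {p : Torus → Prop} (h : ∀ᵐ t ∂arc, p t) :
    ∀ᵐ t ∂arc, p (autTorus lam a t) :=
  (arc_ac_harmonicMeasure a).ae_le
    ((measurePreserving_autTorus lam a).quasiMeasurePreserving.tendsto_ae.eventually h)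

theorem memLp_comp_autTorus (lam : Circle) (a : 𝔻) {q : Torus → ℂ} (hq : MemLp q 2 arc) :
    MemLp (fun t => q (autTorus lam a t)) 2 arc :=
  (hq.comp_measurePreserving (measurePreserving_autTorus lam a)).of_measure_le_smul
    ENNReal.ofReal_ne_top (arc_le_harmonicMeasure a)

theorem measurableEmbedding_autTorus (lam : Circle) (a : 𝔻) :
    MeasurableEmbedding (autTorus lam a) := by
  refine (continuous_autTorus lam a).measurableEmbedding ?_
  exact Function.LeftInverse.injective (autTorus_autTorus lam a)

/-- This justifies substituting `ψ` into the Fourier series of `q` when testing against `φ`. With `φ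
= ζ⁻ⁿ` it yields the Fourier coefficients of `q ∘ ψ`, and with a Cauchy kernel its values in the
disc. -/
theorem hasSum_integral_comp_mul (lam : Circle) (a : 𝔻) {q : Torus → ℂ} (hq : MemLp q 2 arc)
    {φ : Torus → ℂ} (hφ : Continuous φ) :
    HasSum (fun k : ℤ => (∫ t, autBdry lam a t ^ k * φ t ∂arc) * fourierCoeff q k)
      (∫ t, q (autTorus lam a t) * φ t ∂arc) := by
  have hP : ∀ t, ((poisson a t : ℝ) : ℂ) ≠ 0 := fun t => by
    exact_mod_cast (poisson_pos a t).ne'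
  let G : Torus → ℂ := fun t => φ t / ((poisson a t : ℝ) : ℂ)
  have hG : Continuous G := by
    refine hφ.div ?_ hP
    have := continuous_poisson a
    fun_prop
  -- `F` is chosen so that the change of variables turns the integral of `F g` into that of `(g ∘ ψ)
  -- φ`; dividing by the Poisson kernel cancels the Jacobian.
  let F : Torus → ℂ := fun t => G (autTorus lam⁻¹ (lam • a) t)
  have hF : MemLp F 2 arc := by
    have hc : Continuous F := hG.comp (continuous_autTorus _ _)
    obtain ⟨C, hC⟩ := (isCompact_univ (X := Torus)).exists_bound_of_continuousOn hc.continuousOn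
    exact MemLp.of_bound hc.aestronglyMeasurable C (ae_of_all _ fun t => hC t (Set.mem_univ t))
  have key : ∀ g : Torus → ℂ, ∫ t, F t * g t ∂arc = ∫ t, g (autTorus lam a t) * φ t ∂arc := by
    intro g
    rw [← (measurePreserving_autTorus lam a).integral_comp (measurableEmbedding_autTorus lam a),
      integral_harmonicMeasure]
    refine integral_congr_ae (ae_of_all _ fun t => ?_)
    simp only [F, G, autTorus_autTorus]
    have := hP t
    field_simp
  convert! hasSum_integral_mul hF hq using 1
  · funext k
    rw [fourierCoeff_eq F, neg_neg]
    congr 1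
    have := key fun t => pt t ^ k
    simp only [pt_autTorus] at this
    rw [← this]
    simp only [mul_comm]
  · exact (key q).symm

theorem IsHardy.comp_autTorus {q : Torus → ℂ} (hq : IsHardy q) (lam : Circle) (a : 𝔻) :
    IsHardy fun t => q (autTorus lam a t) := by
  refine ⟨memLp_comp_autTorus lam a hq.1, fun n hn => ?_⟩
  have hc : Continuous fun t => pt t ^ (-n) :=
    continuous_pt.zpow₀ _ fun t => Or.inl (pt_ne_zero t)
  have h := hasSum_integral_comp_mul lam a hq.1 hc
  simp only [mul_comm _ (pt _ ^ (-n))] at h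
  rw [fourierCoeff_eq]
  refine h.unique ?_
  convert hasSum_zero with k
  rcases lt_or_ge k 0 with hk | hk
  · rw [hq.2 k hk, mul_zero]
  · lift k to ℕ using hk
    have := (isHardy_autBdry_pow lam a k).2 n hn
    rw [fourierCoeff_eq] at this
    simp only [zpow_natCast]
    rw [this, zero_mul]

theorem IsHardy.cauchy_comp {q : Torus → ℂ} (hq : IsHardy q) (lam : Circle) (a : 𝔻) :
    cauchy (fun t => q (autTorus lam a t)) = cauchy q ∘ aut lam a := by
  funext z
  have hne : ∀ t, 1 - conj (pt t) * (z : ℂ) ≠ 0 := fun t => by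
    rw [conj_pt, mul_comm]
    exact conj_szego_ne z t
  have hc : Continuous fun t => (1 - conj (pt t) * (z : ℂ))⁻¹ := by
    have := continuous_pt
    exact Continuous.inv₀ (by fun_prop) hne
  have h := hasSum_integral_comp_mul lam a hq.1 hc
  refine (h.unique ?_)
  have hinj : Function.Injective ((↑) : ℕ → ℤ) := Nat.cast_injective
  rw [← hinj.hasSum_iff]
  · convert! hasSum_cauchy_int hq.integrable (aut lam a z) using 1
    funext k
    simp only [Function.comp, zpow_natCast, ← div_eq_mul_inv]
    have := cauchy_autBdry_pow lam a z k
    rw [cauchy] at this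
    rw [this, mul_comm]
  · intro k hk
    rw [hq.2 k, mul_zero]
    by_contra h
    exact hk ⟨k.toNat, by omega⟩

/-- The composition operator `C_ψ` on `H²`. -/
def compAut (lam : Circle) (a : 𝔻) (f : H2) : H2 := ((isHardy_bdry f).comp_autTorus lam a).toH2

theorem bdry_compAut (lam : Circle) (a : 𝔻) (f : H2) :
    (compAut lam a f).bdry =ᵐ[arc] fun t => f.bdry (autTorus lam a t) :=
  IsHardy.bdry_toH2 _

theorem eval_compAut (lam : Circle) (a : 𝔻) (f : H2) :
    (compAut lam a f).eval = f.eval ∘ aut lam a := by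
  rw [compAut, IsHardy.eval_toH2, (isHardy_bdry f).cauchy_comp, H2.eval_eq]

theorem compAut_compAut (lam : Circle) (a : 𝔻) (f : H2) :
    compAut lam a (compAut lam⁻¹ (lam • a) f) = f := by
  apply H2.eval_injective
  rw [eval_compAut, eval_compAut]
  funext z
  simp [aut_aut]

/-! ### Annihilators of the Hardy space -/

/-- `z̄ q` is in `H²` if and only if `q` annihilates `H²` in the bilinear pairing. -/
theorem isHardy_inv_pt_mul_iff {q : Torus → ℂ} (hq : MemLp q 2 arc) :
    IsHardy (fun t => (pt t)⁻¹ * q t) ↔ ∀ n : ℕ, fourierCoeff q (-n) = 0 := by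
  have hs : ∀ n : ℤ, fourierCoeff (fun t => (pt t)⁻¹ * q t) n = fourierCoeff q (n + 1) := fun n => by
    simpa using fourierCoeff_zpow_mul (-1) q n
  constructor
  · intro h n
    have := h.2 (-n - 1) (by omega)
    rwa [hs, sub_add_cancel] at this
  · intro h
    refine ⟨by simpa using memLp_zpow_mul (-1) hq, fun n hn => ?_⟩
    rw [hs]
    have := h (-(n + 1)).toNat
    rwa [show -(((-(n + 1)).toNat : ℕ) : ℤ) = n + 1 by omega] at this

theorem integral_mul_eq_zero_of_isHardy {q h : Torus → ℂ} (hq : MemLp q 2 arc)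
    (hq' : IsHardy fun t => (pt t)⁻¹ * q t) (hh : IsHardy h) : ∫ t, q t * h t ∂arc = 0 := by
  rw [isHardy_inv_pt_mul_iff hq] at hq'
  refine (hasSum_integral_mul hq hh.1).unique ?_
  convert hasSum_zero with k
  rcases lt_or_ge k 0 with hk | hk
  · rw [hh.2 k hk, mul_zero]
  · lift k to ℕ using hk
    rw [hq' k, zero_mul]

theorem bdry_norm_le_one {θ : H2} (hθ : IsInner θ ∨ θ = 0) : ∀ᵐ t ∂arc, ‖θ.bdry t‖ ≤ 1 := by
  rcases hθ with h | rfl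
  · filter_upwards [h] with t ht using ht.le
  · filter_upwards [H2.bdry_zero] with t ht
    simp [ht]

theorem memLp_bdry (f : H2) : MemLp f.bdry 2 arc := (isHardy_bdry f).1

/-- Orthogonality to `θ H²` says that `θ f̄` annihilates `H²` in the bilinear pairing, and testing
on monomials suffices. The bound on `θ` covers inner functions and 0 together. -/
theorem mem_modelSpace_iff {θ : H2} (hθ : ∀ᵐ t ∂arc, ‖θ.bdry t‖ ≤ 1) (f : H2) :
    f ∈ modelSpace θ ↔ IsHardy fun t => (pt t)⁻¹ * (θ.bdry t * conj (f.bdry t)) := by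
  have hq : MemLp (fun t => θ.bdry t * conj (f.bdry t)) 2 arc :=
    memLp_bdd_mul (isHardy_bdry θ).1.1 hθ (memLp_bdry f).star
  rw [modelSpace, Submodule.mem_orthogonal']
  constructor
  · intro h
    rw [isHardy_inv_pt_mul_iff hq]
    intro n
    have hH : IsHardy fun t => θ.bdry t * pt t ^ n :=
      (isHardy_bdry θ).bdd_mul hθ (isHardy_pow n)
    have := h hH.toH2 ⟨(isHardy_pow n).toH2, by
      filter_upwards [hH.bdry_toH2, (isHardy_pow n).bdry_toH2] with t h1 h2
      rw [h1, h2]⟩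
    rw [H2.inner_eq] at this
    rw [fourierCoeff_eq, ← this]
    refine integral_congr_ae ?_
    filter_upwards [hH.bdry_toH2] with t h1
    rw [h1, neg_neg, zpow_natCast]
    ring
  · rintro h g ⟨k, hk⟩
    rw [H2.inner_eq, ← integral_mul_eq_zero_of_isHardy hq h (isHardy_bdry k)]
    refine integral_congr_ae ?_
    filter_upwards [hk] with t h1
    rw [h1]
    ring

/-- The product of a bounded function and an element of `H²`, in `L²`. -/
def symbolMul (φ : Lp ℂ ∞ arc) (f : H2) : Lp ℂ 2 arc :=
  (ContinuousLinearMap.mul ℂ ℂ).holder 2 φ (f : Lp ℂ 2 arc)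

theorem coeFn_symbolMul (φ : Lp ℂ ∞ arc) (f : H2) :
    symbolMul φ f =ᵐ[arc] fun t => φ t * f.bdry t :=
  (ContinuousLinearMap.mul ℂ ℂ).coeFn_holder (r := 2) φ (f : Lp ℂ 2 arc)

theorem toeplitz_apply (φ : Lp ℂ ∞ arc) (f : H2) :
    toeplitz φ f = hardy.orthogonalProjectionOnto (symbolMul φ f) := by
  rw [toeplitz, ContinuousLinearMap.comp_apply, ContinuousLinearMap.comp_apply]
  rfl

/-- The projection of `φ f` vanishes when `φ f ⊥ H²`, that is, when the conjugate of `φ f`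
annihilates `H²` in the bilinear pairing. -/
theorem mem_toeplitzKer_iff (φ : Lp ℂ ∞ arc) (f : H2) :
    f ∈ toeplitzKer φ ↔ IsHardy fun t => (pt t)⁻¹ * conj (φ t * f.bdry t) := by
  have h1 : f ∈ toeplitzKer φ ↔ symbolMul φ f ∈ hardyᗮ := by
    rw [toeplitzKer, LinearMap.mem_ker, ContinuousLinearMap.coe_coe, toeplitz_apply,
      Submodule.orthogonalProjectionOnto_eq_zero_iff]
  rw [h1, Submodule.mem_orthogonal']
  clear h1
  have hge := coeFn_symbolMul φ f
  generalize symbolMul φ f = g at *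
  have hq : MemLp (fun t => conj (φ t * f.bdry t)) 2 arc :=
    ((memLp_congr_ae hge).mp (Lp.memLp g)).star
  have h2 : ∀ h : H2, inner ℂ g (h : Lp ℂ 2 arc) =
      ∫ t, conj (φ t * f.bdry t) * h.bdry t ∂arc := fun h => by
    rw [L2.inner_def]
    refine integral_congr_ae ?_
    filter_upwards [hge] with t ht
    rw [RCLike.inner_apply, ht, mul_comm]
    rfl
  constructor
  · intro h
    rw [isHardy_inv_pt_mul_iff hq]
    intro n
    rw [← h (isHardy_pow n).toH2 (isHardy_pow n).toH2.2, h2, fourierCoeff_eq]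
    refine integral_congr_ae ?_
    filter_upwards [(isHardy_pow n).bdry_toH2] with t h3
    rw [h3, neg_neg, zpow_natCast, mul_comm]
  · intro h k hk
    rw [h2 ⟨k, hk⟩, integral_mul_eq_zero_of_isHardy hq h (isHardy_bdry _)]

/-! ### Images of model spaces under composition -/

theorem autTorus_autTorus' (lam : Circle) (a : 𝔻) (t : Torus) :
    autTorus lam a (autTorus lam⁻¹ (lam • a) t) = t := by
  have := autTorus_autTorus lam⁻¹ (lam • a) t
  rwa [inv_inv, inv_smul_smul] at this

theorem isHardy_comp_iff (lam : Circle) (a : 𝔻) {q : Torus → ℂ} :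
    IsHardy (fun t => q (autTorus lam a t)) ↔ IsHardy q := by
  refine ⟨fun h => ?_, fun h => h.comp_autTorus lam a⟩
  have := h.comp_autTorus lam⁻¹ (lam • a)
  simpa only [autTorus_autTorus'] using this

/-- The criterion for `K_θ` pulled back along `ψ`, which replaces `z̄` by `1 / ψ`. All the concrete
forms of `C_ψ(u K_θ)` are rewritings of this condition. -/
theorem mem_modelSpace_iff_compAut (lam : Circle) (a : 𝔻) {θ : H2}
    (hθ : ∀ᵐ t ∂arc, ‖θ.bdry t‖ ≤ 1) (f : H2) :
    f ∈ modelSpace θ ↔ IsHardy fun t => (autBdry lam a t)⁻¹ *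
      ((compAut lam a θ).bdry t * conj ((compAut lam a f).bdry t)) := by
  rw [mem_modelSpace_iff hθ, ← isHardy_comp_iff lam a]
  refine isHardy_congr ?_
  filter_upwards [bdry_compAut lam a θ, bdry_compAut lam a f] with t h1 h2
  rw [h1, h2, pt_autTorus]

/-- As `C_ψ` is onto `H²`, an identity between sets of functions reduces to an equivalence of
membership conditions. -/
theorem compSet_mulSet_fns (lam : Circle) (a : 𝔻) (w : 𝔻 → ℂ) {S S' : Submodule ℂ H2}
    (h : ∀ f, f ∈ S ↔ compAut lam a f ∈ S') :
    compSet (aut lam a) (mulSet w (fns S)) = mulSet (w ∘ aut lam a) (fns S') := by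
  ext F
  simp only [compSet, mulSet, fns, Set.mem_image, SetLike.mem_coe, exists_exists_and_eq_and]
  constructor
  · rintro ⟨f, hf, rfl⟩
    exact ⟨compAut lam a f, (h f).mp hf, by rw [eval_compAut]; rfl⟩
  · rintro ⟨g, hg, rfl⟩
    refine ⟨compAut lam⁻¹ (lam • a) g, (h _).mpr (by rwa [compAut_compAut]), ?_⟩
    conv_rhs => rw [← compAut_compAut lam a g, eval_compAut]
    rfl

theorem IsInner.compAut {θ : H2} (h : IsInner θ) (lam : Circle) (a : 𝔻) :
    IsInner (compAut lam a θ) := by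
  filter_upwards [bdry_compAut lam a θ, ae_comp_autTorus lam a h] with t h1 h2
  rw [h1, h2]

theorem norm_bdry_compAut_le {θ : H2} (h : ∀ᵐ t ∂arc, ‖θ.bdry t‖ ≤ 1) (lam : Circle) (a : 𝔻) :
    ∀ᵐ t ∂arc, ‖(compAut lam a θ).bdry t‖ ≤ 1 := by
  filter_upwards [bdry_compAut lam a θ, ae_comp_autTorus lam a h] with t h1 h2
  rwa [h1]

theorem memLp_symbolFn (lam : Circle) (a : 𝔻) {Θ : H2} (hΘ : ∀ᵐ t ∂arc, ‖Θ.bdry t‖ ≤ 1) :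
    MemLp (symbolFn lam a Θ) ∞ arc := by
  have hm : AEStronglyMeasurable (symbolFn lam a Θ) arc := by
    have h1 : AEStronglyMeasurable (fun t => conj (Θ.bdry t)) arc := (memLp_bdry Θ).star.1
    have h2 : Continuous fun t => autBdry lam a t / pt t :=
      (autBdry lam a).continuous.div continuous_pt pt_ne_zero
    refine (h1.mul h2.aestronglyMeasurable).congr (ae_of_all _ fun t => ?_)
    simp only [symbolFn, Pi.mul_apply, mul_div_assoc]
  refine memLp_top_of_bound hm 1 ?_
  filter_upwards [hΘ] with t ht
  simpa [symbolFn] using ht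

/-- For this symbol the factor `z̄` in the kernel criterion cancels the conjugate of `1 / z`, which
leaves `ψ̄ = 1 / ψ`. -/
theorem compSet_modelSpace_eq_toeplitzKer (lam : Circle) (a : 𝔻) (u : H2) {θ : H2}
    (hθ : ∀ᵐ t ∂arc, ‖θ.bdry t‖ ≤ 1)
    (hG : MemLp (symbolFn lam a (compAut lam a θ)) ∞ arc) :
    compSet (aut lam a) (mulSet u.eval (fns (modelSpace θ))) =
      mulSet (u.eval ∘ aut lam a) (fns (toeplitzKer hG.toLp)) := by
  refine compSet_mulSet_fns lam a _ fun f => ?_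
  rw [mem_modelSpace_iff_compAut lam a hθ, mem_toeplitzKer_iff]
  refine isHardy_congr ?_
  filter_upwards [hG.coeFn_toLp] with t ht
  rw [ht, symbolFn]
  have := pt_ne_zero t
  simp only [map_mul, map_div₀, conj_conj, conj_autBdry, conj_pt]
  field_simp

theorem isHardy_div_pt {θ : H2} (h : θ.eval 0 = 0) :
    IsHardy fun t => (pt t)⁻¹ * θ.bdry t := by
  have hs : ∀ n : ℤ, fourierCoeff (fun t => (pt t)⁻¹ * θ.bdry t) n =
      fourierCoeff θ.bdry (n + 1) := fun n => by
    simpa using fourierCoeff_zpow_mul (-1) θ.bdry n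
  refine ⟨by simpa using memLp_zpow_mul (-1) (memLp_bdry θ), fun n hn => ?_⟩
  rw [hs]
  rcases lt_or_ge (n + 1) 0 with h1 | h1
  · exact (isHardy_bdry θ).2 _ h1
  · rw [show n + 1 = 0 by omega, fourierCoeff_eq]
    rw [H2.eval_eq, cauchy_zero] at h
    simpa using h

theorem exists_compSet_modelSpace_of_eval_eq_zero (lam : Circle) (a : 𝔻) (u : H2) {θ : H2}
    (hθ : ∀ᵐ t ∂arc, ‖θ.bdry t‖ ≤ 1) (h0 : θ.eval 0 = 0) :
    ∃ χ : H2, (∀ z : 𝔻, χ.eval z * (aut lam a z : ℂ) = (z : ℂ) * θ.eval (aut lam a z)) ∧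
      (IsInner θ → IsInner χ) ∧
      compSet (aut lam a) (mulSet u.eval (fns (modelSpace θ))) =
        mulSet (u.eval ∘ aut lam a) (fns (modelSpace χ)) := by
  have h1 := isHardy_div_pt h0
  have hχ := isHardy_pt.bdd_mul (C := 1) (ae_of_all _ fun t => (norm_pt t).le)
    (h1.comp_autTorus lam a)
  have hb : hχ.toH2.bdry =ᵐ[arc]
      fun t => pt t * ((autBdry lam a t)⁻¹ * (compAut lam a θ).bdry t) := by
    filter_upwards [hχ.bdry_toH2, bdry_compAut lam a θ] with t e1 e2
    rw [e1, e2, pt_autTorus]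
  refine ⟨hχ.toH2, fun z => ?_, fun hi => ?_, compSet_mulSet_fns lam a _ fun f => ?_⟩
  · have h2 : cauchy θ.bdry (aut lam a z) =
        aut lam a z * cauchy (fun t => (pt t)⁻¹ * θ.bdry t) (aut lam a z) := by
      have := congrFun (isHardy_pt.cauchy_mul h1) (aut lam a z)
      rw [Pi.mul_apply, cauchy_pt] at this
      rw [← this]
      refine congrFun (cauchy_congr (ae_of_all _ fun t => ?_)) _
      exact (mul_inv_cancel_left₀ (pt_ne_zero t) _).symm
    rw [hχ.eval_toH2, isHardy_pt.cauchy_mul (h1.comp_autTorus lam a), Pi.mul_apply, cauchy_pt,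
      h1.cauchy_comp, H2.eval_eq, h2, Function.comp]
    ring
  · filter_upwards [hb, hi.compAut lam a] with t e1 e2
    rw [e1]
    simp [e2]
  -- On the circle `z̄ χ = (θ∘ψ) / ψ`, so the two criteria coincide.
  · rw [mem_modelSpace_iff_compAut lam a hθ, mem_modelSpace_iff]
    · refine isHardy_congr ?_
      filter_upwards [hb] with t e1
      rw [e1]
      have := pt_ne_zero t
      field_simp
    · filter_upwards [hb, norm_bdry_compAut_le hθ lam a] with t e1 e2
      rw [e1]
      simpa using e2

theorem isHardy_one_sub_mul_pt (a : 𝔻) : IsHardy fun t => 1 - conj (a : ℂ) * pt t :=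
  (isHardy_const 1).sub (isHardy_pt.const_mul _)

theorem norm_one_sub_mul_pt_le (a : 𝔻) (t : Torus) : ‖1 - conj (a : ℂ) * pt t‖ ≤ 2 := by
  refine (norm_sub_le _ _).trans ?_
  rw [norm_mul, RCLike.norm_conj, norm_pt, norm_one]
  linarith [a.norm_lt_one]

theorem cauchy_one_sub_mul_pt (a z : 𝔻) :
    cauchy (fun t => 1 - conj (a : ℂ) * pt t) z = 1 - conj (a : ℂ) * z := by
  rw [cauchy_sub (isHardy_const 1).integrable (isHardy_pt.const_mul _).integrable, cauchy_const,
    cauchy_const_mul, cauchy_pt]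

/-- Both `1 - ā z` and its inverse, the Cauchy kernel, are bounded and analytic. -/
theorem isHardy_one_sub_mul_iff (a : 𝔻) {q : Torus → ℂ} :
    IsHardy (fun t => (1 - conj (a : ℂ) * pt t) * q t) ↔ IsHardy q := by
  refine ⟨fun h => ?_, fun h => (isHardy_one_sub_mul_pt a).bdd_mul
    (ae_of_all _ (norm_one_sub_mul_pt_le a)) h⟩
  refine ((isHardy_szego a).bdd_mul (ae_of_all _ (norm_szego_le a)) h).congr
    (ae_of_all _ fun t => ?_)
  simp only [szego]
  rw [inv_mul_cancel_left₀ (szego_ne a t)]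

theorem compSet_modelSpace_eq_one_sub_mul (lam : Circle) (a : 𝔻) (u : H2) {θ : H2}
    (hθ : ∀ᵐ t ∂arc, ‖θ.bdry t‖ ≤ 1) :
    compSet (aut lam a) (mulSet u.eval (fns (modelSpace θ))) =
      mulSet ((fun z : 𝔻 => 1 - conj (a : ℂ) * (z : ℂ)) * (u.eval ∘ aut lam a))
        (fns (modelSpace (compAut lam a θ))) := by
  have key : ∀ f g : H2, ((compAut lam a f).bdry =ᵐ[arc]
      fun t => (1 - conj (a : ℂ) * pt t) * g.bdry t) →
      (f ∈ modelSpace θ ↔ g ∈ modelSpace (compAut lam a θ)) := by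
    intro f g h
    rw [mem_modelSpace_iff_compAut lam a hθ, mem_modelSpace_iff (norm_bdry_compAut_le hθ lam a)]
    rw [← isHardy_one_sub_mul_iff a (q := fun t => (pt t)⁻¹ * _)]
    have hl : (lam : ℂ) ≠ 0 := Circle.coe_ne_zero _
    have e : (fun t => (autBdry lam a t)⁻¹ *
        ((compAut lam a θ).bdry t * conj ((compAut lam a f).bdry t))) =ᵐ[arc]
        fun t => -(lam : ℂ)⁻¹ * ((1 - conj (a : ℂ) * pt t) * ((pt t)⁻¹ *
          ((compAut lam a θ).bdry t * conj (g.bdry t)))) := by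
      filter_upwards [h] with t ht
      -- The conjugate of the factor `1 - ā z` combines with `1 / ψ` to give `z̄` times the analytic
      -- factor `1 - ā z`, up to the constant `-λ⁻¹`.
      have h1 : (autBdry lam a t)⁻¹ * (1 - a * (pt t)⁻¹) =
          -(lam : ℂ)⁻¹ * (1 - conj (a : ℂ) * pt t) * (pt t)⁻¹ := by
        have h2 := autBdry_div_pt lam a t
        have h3 := szego_ne a t
        have h4 := autBdry_ne_zero lam a t
        have h5 := pt_ne_zero t
        have h6 : szego a t * (1 - conj (a : ℂ) * pt t) = 1 := inv_mul_cancel₀ h3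
        have h7 : (lam : ℂ)⁻¹ * lam = 1 := inv_mul_cancel₀ hl
        rw [inv_mul_eq_iff_eq_mul₀ h4]
        linear_combination (lam : ℂ)⁻¹ * (1 - conj (a : ℂ) * pt t) * h2 -
          (1 - a * (pt t)⁻¹) * ((lam : ℂ)⁻¹ * lam * h6 + h7)
      rw [ht]
      simp only [map_mul, map_sub, map_one, conj_conj, conj_pt]
      linear_combination ((compAut lam a θ).bdry t * conj (g.bdry t)) * h1
    rw [isHardy_congr e]
    refine ⟨fun h => ?_, fun h => h.const_mul _⟩
    have := h.const_mul (-(lam : ℂ))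
    refine this.congr (ae_of_all _ fun t => ?_)
    simp only
    field_simp
  ext F
  simp only [compSet, mulSet, fns, Set.mem_image, SetLike.mem_coe, exists_exists_and_eq_and]
  have hev : ∀ f g : H2, ((compAut lam a f).bdry =ᵐ[arc]
      fun t => (1 - conj (a : ℂ) * pt t) * g.bdry t) →
      (fun z : 𝔻 => 1 - conj (a : ℂ) * (z : ℂ)) * (u.eval ∘ aut lam a) * g.eval =
      (u.eval * f.eval) ∘ aut lam a := by
    intro f g h
    have h1 := cauchy_congr h
    rw [← H2.eval_eq, (isHardy_one_sub_mul_pt a).cauchy_mul (isHardy_bdry g), eval_compAut] at h1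
    funext z
    have h2 := congrFun h1 z
    simp only [Function.comp, Pi.mul_apply, cauchy_one_sub_mul_pt, ← H2.eval_eq] at h2 ⊢
    rw [h2]
    ring
  constructor
  · rintro ⟨f, hf, rfl⟩
    have hg := (isHardy_szego a).bdd_mul (ae_of_all _ (norm_szego_le a))
      (isHardy_bdry (compAut lam a f))
    have hfg : (compAut lam a f).bdry =ᵐ[arc]
        fun t => (1 - conj (a : ℂ) * pt t) * hg.toH2.bdry t := by
      filter_upwards [hg.bdry_toH2] with t ht
      rw [ht, szego, mul_inv_cancel_left₀ (szego_ne a t)]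
    exact ⟨hg.toH2, (key f _ hfg).mp hf, hev f _ hfg⟩
  · rintro ⟨g, hg, rfl⟩
    have hf := (isHardy_one_sub_mul_pt a).bdd_mul (ae_of_all _ (norm_one_sub_mul_pt_le a))
      (isHardy_bdry g)
    have hfg : (compAut lam a (compAut lam⁻¹ (lam • a) hf.toH2)).bdry =ᵐ[arc]
        fun t => (1 - conj (a : ℂ) * pt t) * g.bdry t := by
      rw [compAut_compAut]
      exact hf.bdry_toH2
    exact ⟨_, (key _ g hfg).mpr hg, (hev _ g hfg).symm⟩

/-! ### Rank-one perturbations of contractions with strongly vanishing powers -/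

section Contraction

variable {H : Type*} [NormedAddCommGroup H] [InnerProductSpace ℂ H]

theorem norm_pow_apply_le {R : H →L[ℂ] H} (hR : ∀ x, ‖R x‖ ≤ ‖x‖) (n : ℕ) (x : H) :
    ‖(R ^ n) x‖ ≤ ‖x‖ := by
  induction n with
  | zero => simp
  | succ n ih =>
    rw [pow_succ', mul_apply_eq_comp]
    exact (hR _).trans ih

theorem pow_apply_pow (R : H →L[ℂ] H) (m n : ℕ) (x : H) :
    (R ^ m) ((R ^ n) x) = (R ^ (m + n)) x := by
  rw [pow_add, mul_apply_eq_comp]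

/-- The resolvent of a contraction has real part at least one half. -/
theorem half_norm_sq_le_re_tsum [CompleteSpace H] {R : H →L[ℂ] H} (hR : ∀ x, ‖R x‖ ≤ ‖x‖) (p : H)
    {c : ℂ} (hc : ‖c‖ < 1) :
    ‖p‖ ^ 2 / 2 ≤ (∑' j : ℕ, c ^ j * inner ℂ ((R ^ j) p) p).re := by
  have hs : Summable fun j : ℕ => conj c ^ j • (R ^ j) p := by
    refine Summable.of_norm_bounded
      ((summable_geometric_of_lt_one (norm_nonneg _) hc).mul_right ‖p‖) fun j => ?_
    rw [norm_smul, norm_pow, RCLike.norm_conj]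
    exact mul_le_mul_of_nonneg_left (norm_pow_apply_le hR j p) (by positivity)
  set x := ∑' j : ℕ, conj c ^ j • (R ^ j) p with hx
  have h1 : ∑' j : ℕ, c ^ j * inner ℂ ((R ^ j) p) p = inner ℂ x p := by
    have h2 := (hs.hasSum.mapL (innerSL ℂ p)).tsum_eq
    simp only [innerSL_apply_apply, inner_smul_right] at h2
    rw [← inner_conj_symm x p, ← h2, conj_tsum]
    refine tsum_congr fun j => ?_
    rw [map_mul, map_pow, conj_conj, inner_conj_symm]
  -- The Neumann series `x` solves `(1 - c̄ R) x = p`. With `y = c̄ R x`, `Re ⟪x, p⟫ - ‖p‖² / 2 =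
  -- (‖x‖² - ‖y‖²) / 2 ≥ 0`.
  have h2 : x = p + conj c • R x := by
    have h3 : R x = ∑' j : ℕ, R (conj c ^ j • (R ^ j) p) := R.map_tsum hs
    rw [h3, ← tsum_const_smul'', hx, hs.tsum_eq_zero_add]
    congr 1
    · simp
    · refine tsum_congr fun j => ?_
      rw [map_smul, smul_smul, ← pow_succ', pow_succ' R, mul_apply_eq_comp]
  rw [h1]
  set y := conj c • R x
  have hy : ‖y‖ ≤ ‖x‖ := by
    rw [norm_smul, RCLike.norm_conj]
    exact (mul_le_of_le_one_left (norm_nonneg _) hc.le).trans (hR x)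
  have hp : p = x - y := eq_sub_of_add_eq h2.symm
  have h3 : ‖p‖ ^ 2 = ‖x‖ ^ 2 - 2 * (inner ℂ x y : ℂ).re + ‖y‖ ^ 2 := by
    rw [hp]
    exact norm_sub_sq (𝕜 := ℂ) x y
  have h4 : (inner ℂ x p : ℂ).re = ‖x‖ ^ 2 - (inner ℂ x y : ℂ).re := by
    rw [hp, inner_sub_right, inner_self_eq_norm_sq_to_K, sub_re]
    norm_cast
  rw [h3, h4]
  nlinarith [norm_nonneg y]

variable [CompleteSpace H]

theorem norm_adjoint_apply_le {R : H →L[ℂ] H} (hR : ∀ x, ‖R x‖ ≤ ‖x‖) (x : H) :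
    ‖ContinuousLinearMap.adjoint R x‖ ≤ ‖x‖ := by
  have h1 : ‖R‖ ≤ 1 := R.opNorm_le_bound zero_le_one fun x => by simpa using hR x
  refine (ContinuousLinearMap.le_opNorm _ _).trans ?_
  rw [LinearIsometryEquiv.norm_map]
  exact mul_le_of_le_one_left (norm_nonneg _) h1

/-- Expanding the square gives the cross term `-2 ‖Rᵏ y‖²`, and the last square is at most `‖Rᵏ
y‖²`. -/
theorem norm_sub_adjoint_sq_le {R : H →L[ℂ] H} (hR : ∀ x, ‖R x‖ ≤ ‖x‖) (k : ℕ) (y : H) :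
    ‖y - ContinuousLinearMap.adjoint (R ^ k) ((R ^ k) y)‖ ^ 2 ≤ ‖y‖ ^ 2 - ‖(R ^ k) y‖ ^ 2 := by
  have h := norm_sub_sq (𝕜 := ℂ) y (ContinuousLinearMap.adjoint (R ^ k) ((R ^ k) y))
  rw [ContinuousLinearMap.adjoint_inner_right, inner_self_eq_norm_sq_to_K] at h
  have h2 : RCLike.re (((‖(R ^ k) y‖ : ℝ) : ℂ) ^ 2) = ‖(R ^ k) y‖ ^ 2 := by
    norm_cast
  have h3 := norm_adjoint_apply_le (norm_pow_apply_le hR k) ((R ^ k) y)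
  have h4 := pow_le_pow_left₀ (norm_nonneg _) h3 2
  simp only [RCLike.ofReal_eq_complex_ofReal] at h
  rw [h2] at h
  linarith

/-- The sequence `R*ⁿ Rⁿ` converges strongly for a contraction `R`. -/
theorem exists_tendsto_adjoint_pow {R : H →L[ℂ] H} (hR : ∀ x, ‖R x‖ ≤ ‖x‖) (x : H) :
    ∃ y, Tendsto (fun n : ℕ => ContinuousLinearMap.adjoint (R ^ n) ((R ^ n) x)) atTop (𝓝 y) := by
  refine cauchySeq_tendsto_of_complete ?_
  have hanti : Antitone fun n : ℕ => ‖(R ^ n) x‖ ^ 2 := by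
    refine antitone_nat_of_succ_le fun n => ?_
    rw [pow_succ' R, mul_apply_eq_comp]
    exact pow_le_pow_left₀ (norm_nonneg _) (hR _) 2
  obtain ⟨l, hl⟩ : ∃ l, Tendsto (fun n : ℕ => ‖(R ^ n) x‖ ^ 2) atTop (𝓝 l) :=
    ⟨_, tendsto_atTop_ciInf hanti ⟨0, by rintro _ ⟨n, rfl⟩; positivity⟩⟩
  have hb : ∀ n, l ≤ ‖(R ^ n) x‖ ^ 2 := fun n => hanti.le_of_tendsto hl n
  -- The squared distance between terms `n ≤ m` is at most `‖Rⁿ x‖² - ‖Rᵐ x‖²`, and `‖Rⁿ x‖²`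
  -- decreases to `l`.
  refine cauchySeq_of_le_tendsto_0' (fun n => √(‖(R ^ n) x‖ ^ 2 - l)) (fun n m hnm => ?_) ?_
  · obtain ⟨k, rfl⟩ := Nat.exists_eq_add_of_le hnm
    rw [dist_eq_norm]
    have e : ContinuousLinearMap.adjoint (R ^ n) ((R ^ n) x) -
        ContinuousLinearMap.adjoint (R ^ (n + k)) ((R ^ (n + k)) x) =
        ContinuousLinearMap.adjoint (R ^ n) ((R ^ n) x -
          ContinuousLinearMap.adjoint (R ^ k) ((R ^ k) ((R ^ n) x))) := by
      have e2 : ContinuousLinearMap.adjoint (R ^ (k + n)) =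
          ContinuousLinearMap.adjoint (R ^ n) ∘L ContinuousLinearMap.adjoint (R ^ k) := by
        rw [pow_add, ContinuousLinearMap.mul_def, ContinuousLinearMap.adjoint_comp]
      rw [map_sub, pow_apply_pow, add_comm n k, e2]
      rfl
    rw [e]
    refine (norm_adjoint_apply_le (norm_pow_apply_le hR n) _).trans ?_
    refine Real.le_sqrt_of_sq_le ((norm_sub_adjoint_sq_le hR k _).trans ?_)
    rw [pow_apply_pow]
    linarith [hb (k + n)]
  · have h := (Real.continuous_sqrt.tendsto _).comp (hl.sub_const l)
    rw [sub_self, Real.sqrt_zero] at h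
    exact h

/-- Let `T` be a contraction with `Tⁿ → 0` strongly, and let `u` be a unit vector. If the moments
`⟪u, Tʲ u⟫` are the Fourier coefficients of a probability density, then `R = T (1 - u ⊗ u)` satisfies
`Rⁿ → 0` strongly as well. -/
theorem tendsto_pow_rankOne_perturbation {T R : H →L[ℂ] H} {u : H}
    (hT0 : ∀ x, Tendsto (fun n : ℕ => (T ^ n) x) atTop (𝓝 0))
    (hR : ∀ x, ‖R x‖ ≤ ‖x‖) (hRT : ∀ x, R x = T x - (inner ℂ u x : ℂ) • T u) (hu : R u = 0)
    {w : Torus → ℝ} (hw : Integrable w arc) (hw0 : ∀ t, 0 ≤ w t) (hw1 : ∫ t, w t ∂arc = 1)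
    (hmom : ∀ j : ℕ, inner ℂ u ((T ^ j) u) = ∫ t, (w t : ℂ) * conj (pt t) ^ j ∂arc) (x : H) :
    Tendsto (fun n : ℕ => ‖(R ^ n) x‖) atTop (𝓝 0) := by
  -- `⟪A x, x⟫` is the limit of `‖Rⁿ x‖²`, so the goal is that it vanishes.
  choose A hA using exists_tendsto_adjoint_pow hR
  have hAi : ∀ f g, Tendsto (fun n : ℕ => (inner ℂ ((R ^ n) f) ((R ^ n) g) : ℂ)) atTop
      (𝓝 (inner ℂ (A f) g)) := fun f g => by
    refine ((hA f).inner tendsto_const_nhds).congr fun n => ?_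
    rw [ContinuousLinearMap.adjoint_inner_left]
  have hAnorm : ∀ f, ‖A f‖ ≤ ‖f‖ := fun f =>
    le_of_tendsto (hA f).norm (Eventually.of_forall fun n =>
      (norm_adjoint_apply_le (norm_pow_apply_le hR n) _).trans (norm_pow_apply_le hR n f))
  have hAR : ∀ f g, inner ℂ (A (R f)) (R g) = (inner ℂ (A f) g : ℂ) := fun f g => by
    refine tendsto_nhds_unique (hAi (R f) (R g)) (((tendsto_add_atTop_iff_nat 1).mpr
      (hAi f g)).congr fun n => ?_)
    rw [pow_succ, mul_apply_eq_comp, mul_apply_eq_comp]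
  have hARn : ∀ (n : ℕ) f g, inner ℂ (A ((R ^ n) f)) ((R ^ n) g) = (inner ℂ (A f) g : ℂ) := by
    intro n f g
    induction n with
    | zero => simp
    | succ n ih =>
      rw [pow_succ', mul_apply_eq_comp, mul_apply_eq_comp, hAR, ih]
  have hAsymm : ∀ f g, (inner ℂ (A f) g : ℂ) = conj (inner ℂ (A g) f) := fun f g => by
    refine tendsto_nhds_unique (hAi f g) (((continuous_conj.tendsto _).comp (hAi g f)).congr
      fun n => ?_)
    simp only [Function.comp, inner_conj_symm]
  have hAu : A u = 0 := by
    refine tendsto_nhds_unique ((tendsto_add_atTop_iff_nat 1).mpr (hA u))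
      (tendsto_const_nhds.congr fun n => ?_)
    rw [pow_succ, mul_apply_eq_comp, hu, map_zero, map_zero]
  -- Replacing one `R` by `T - T u ⊗ u` in `R* A R = A` produces an error term that involves only
  -- this vector.
  set p := ContinuousLinearMap.adjoint R (A (T u)) with hp
  have hexp : ∀ (n : ℕ) f g, (inner ℂ (A f) g : ℂ) = inner ℂ (A ((R ^ n) f)) ((T ^ n) g) -
      ∑ j ∈ Finset.range n, inner ℂ u ((T ^ j) g) * inner ℂ ((R ^ j) f) p := by
    intro n f g
    induction n with
    | zero => simp
    | succ n ih =>
      rw [ih, Finset.sum_range_succ, ← hAR, hRT ((T ^ n) g), inner_sub_right, inner_smul_right]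
      have e : inner ℂ (A (R ((R ^ n) f))) (T u) = (inner ℂ ((R ^ n) f) p : ℂ) := by
        rw [hAsymm, hp, ContinuousLinearMap.adjoint_inner_right, inner_conj_symm]
      rw [e, pow_succ' R, pow_succ' T, mul_apply_eq_comp,
        mul_apply_eq_comp]
      ring
  have hlim : ∀ f g, Tendsto (fun n : ℕ => ∑ j ∈ Finset.range n,
      (inner ℂ u ((T ^ j) g) * inner ℂ ((R ^ j) f) p : ℂ)) atTop (𝓝 (-inner ℂ (A f) g)) := by
    intro f g
    have h0 : Tendsto (fun n : ℕ => (inner ℂ (A ((R ^ n) f)) ((T ^ n) g) : ℂ)) atTop (𝓝 0) := by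
      refine squeeze_zero_norm (a := fun n => ‖f‖ * ‖(T ^ n) g‖) (fun n => ?_) ?_
      · refine (norm_inner_le_norm _ _).trans (mul_le_mul_of_nonneg_right ?_ (norm_nonneg _))
        exact (hAnorm _).trans (norm_pow_apply_le hR n f)
      · simpa using (hT0 g).norm.const_mul ‖f‖
    have h1 := h0.sub_const (inner ℂ (A f) g)
    rw [zero_sub] at h1
    refine h1.congr fun n => ?_
    rw [hexp n f g]
    ring
  -- For `f = p`, `g = u` the series sums to 0 because `A u = 0`; by Abel's theorem its Abel means
  -- tend to 0, while positivity keeps their real parts at least `‖p‖² / 2`.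
  have hp0 : p = 0 := by
    have h1 := hlim p u
    rw [hAsymm, hAu, inner_zero_left, map_zero, neg_zero] at h1
    have h2 := Complex.tendsto_tsum_powerSeries_nhdsWithin_lt h1
    rw [tendsto_map'_iff] at h2
    have h3 : ∀ᶠ r : ℝ in 𝓝[<] 1, ‖p‖ ^ 2 / 2 ≤ (∑' j : ℕ, (inner ℂ u ((T ^ j) u) *
        inner ℂ ((R ^ j) p) p) * (r : ℂ) ^ j).re := by
      filter_upwards [Ioo_mem_nhdsLT (zero_lt_one' ℝ)] with r hr
      have hd : ∀ j : ℕ, ‖(inner ℂ ((R ^ j) p) p : ℂ)‖ ≤ ‖p‖ * ‖p‖ := fun j =>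
        (norm_inner_le_norm _ _).trans
          (mul_le_mul_of_nonneg_right (norm_pow_apply_le hR j p) (norm_nonneg _))
      have hrn : ‖(r : ℂ)‖ = r := by rw [norm_real, Real.norm_of_nonneg hr.1.le]
      have hsum : Summable fun j : ℕ => r ^ j * (‖p‖ * ‖p‖) :=
        (summable_geometric_of_lt_one hr.1.le hr.2).mul_right _
      have hF : ∀ (j : ℕ) t, ‖(r * conj (pt t)) ^ j * (inner ℂ ((R ^ j) p) p : ℂ)‖ ≤
          r ^ j * (‖p‖ * ‖p‖) := fun j t => by
        rw [norm_mul, norm_pow, norm_mul, hrn, RCLike.norm_conj, norm_pt, mul_one]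
        exact mul_le_mul_of_nonneg_left (hd j) (pow_nonneg hr.1.le _)
      have hcont : ∀ j : ℕ, Continuous fun t =>
          (r * conj (pt t)) ^ j * (inner ℂ ((R ^ j) p) p : ℂ) := fun j => by
        have := continuous_pt
        fun_prop
      -- Writing `⟪u, Tʲ u⟫` as a moment of `w` turns the Abel mean into the `w`-average of `D`,
      -- whose real part is bounded below by the resolvent estimate with `c = r ζ̄`.
      let D : Torus → ℂ := fun t => ∑' j : ℕ, (r * conj (pt t)) ^ j * inner ℂ ((R ^ j) p) p
      have hD : Continuous D := continuous_tsum hcont hsum hF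
      obtain ⟨C, hC⟩ := (isCompact_univ (X := Torus)).exists_bound_of_continuousOn hD.continuousOn
      have hwD : Integrable (fun t => (w t : ℂ) * D t) arc :=
        hw.ofReal.mul_bdd hD.aestronglyMeasurable
          (ae_of_all _ fun t => hC t (Set.mem_univ t))
      have hint : ∀ j : ℕ, Integrable
          (fun t => (w t : ℂ) * ((r * conj (pt t)) ^ j * inner ℂ ((R ^ j) p) p)) arc := fun j =>
        hw.ofReal.mul_bdd (hcont j).aestronglyMeasurable (ae_of_all _ (hF j))
      have hsw : HasSum (fun j : ℕ => ∫ t, (w t : ℂ) * ((r * conj (pt t)) ^ j *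
          inner ℂ ((R ^ j) p) p) ∂arc) (∫ t, (w t : ℂ) * D t ∂arc) := by
        have h4 := hasSum_integral_of_summable_integral_norm (μ := arc) hint ?_
        · simpa only [tsum_mul_left] using h4
        · refine Summable.of_nonneg_of_le (fun j => integral_nonneg fun t => norm_nonneg _)
            (fun j => ?_) hsum
          have : ∫ t, w t * (r ^ j * (‖p‖ * ‖p‖)) ∂arc = r ^ j * (‖p‖ * ‖p‖) := by
            rw [integral_mul_const, hw1, one_mul]
          rw [← this]
          refine integral_mono (hint j).norm (hw.mul_const _) fun t => ?_
          simp only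
          rw [norm_mul, norm_real, Real.norm_of_nonneg (hw0 t)]
          exact mul_le_mul_of_nonneg_left (hF j t) (hw0 t)
      have e : ∑' j : ℕ, (inner ℂ u ((T ^ j) u) * inner ℂ ((R ^ j) p) p) * (r : ℂ) ^ j =
          ∫ t, (w t : ℂ) * D t ∂arc := by
        rw [← hsw.tsum_eq]
        refine tsum_congr fun j => ?_
        rw [hmom, mul_assoc, ← integral_mul_const]
        refine integral_congr_ae (ae_of_all _ fun t => ?_)
        simp only [mul_pow]
        ring
      rw [e]
      have h5 : (∫ t, (w t : ℂ) * D t ∂arc).re = ∫ t, w t * (D t).re ∂arc := by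
        have := integral_re hwD
        simp only [RCLike.re_eq_complex_re, re_ofReal_mul] at this
        exact this.symm
      have h6 : ∫ t, w t * (‖p‖ ^ 2 / 2) ∂arc = ‖p‖ ^ 2 / 2 := by
        rw [integral_mul_const, hw1, one_mul]
      rw [h5, ← h6]
      refine integral_mono (hw.mul_const _) ?_ fun t => ?_
      · have := hwD.re
        simpa only [RCLike.re_eq_complex_re, re_ofReal_mul] using this
      · refine mul_le_mul_of_nonneg_left (half_norm_sq_le_re_tsum hR p ?_) (hw0 t)
        rw [norm_mul, hrn, RCLike.norm_conj, norm_pt, mul_one]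
        exact hr.2
    have h4 := ge_of_tendsto ((continuous_re.tendsto _).comp h2) h3
    rw [zero_re] at h4
    have : ‖p‖ ^ 2 = 0 := le_antisymm (by linarith) (by positivity)
    simpa using this
  -- With `p = 0` every partial sum is 0, and these sums converge to `-⟪A x, x⟫`.
  have hzero : (inner ℂ (A x) x : ℂ) = 0 := by
    have h := tendsto_nhds_unique (hlim x x) (b := (0 : ℂ)) (by simp [hp0])
    exact neg_eq_zero.mp h
  have h := (hAi x x).norm
  rw [hzero, norm_zero] at h
  have h2 := (Real.continuous_sqrt.tendsto _).comp h
  rw [Real.sqrt_zero] at h2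
  refine h2.congr fun n => ?_
  rw [Function.comp, inner_self_eq_norm_sq_to_K, norm_pow]
  simp

end Contraction

/-! ### Shift and backward shift -/

theorem isHardy_pt_mul (f : H2) : IsHardy fun t => pt t * f.bdry t :=
  isHardy_pt.bdd_mul (C := 1) (ae_of_all _ fun t => (norm_pt t).le) (isHardy_bdry f)

/-- The shift operator `f ↦ z f` on `H²`. -/
def shift : H2 →ₗᵢ[ℂ] H2 :=
  LinearMap.isometryOfInner
    { toFun := fun f => (isHardy_pt_mul f).toH2
      map_add' := fun f g => H2.ext_bdry (by
        filter_upwards [(isHardy_pt_mul (f + g)).bdry_toH2, (isHardy_pt_mul f).bdry_toH2,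
          (isHardy_pt_mul g).bdry_toH2, H2.bdry_add f g,
          H2.bdry_add (isHardy_pt_mul f).toH2 (isHardy_pt_mul g).toH2] with t h1 h2 h3 h4 h5
        rw [h1, h5, h2, h3, h4, mul_add])
      map_smul' := fun c f => H2.ext_bdry (by
        filter_upwards [(isHardy_pt_mul (c • f)).bdry_toH2, (isHardy_pt_mul f).bdry_toH2,
          H2.bdry_smul c f, H2.bdry_smul c (isHardy_pt_mul f).toH2] with t h1 h2 h3 h4
        rw [h1, RingHom.id_apply, h4, h2, h3, mul_left_comm]) }
    fun f g => by
      rw [H2.inner_eq, H2.inner_eq]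
      refine integral_congr_ae ?_
      filter_upwards [(isHardy_pt_mul f).bdry_toH2, (isHardy_pt_mul g).bdry_toH2] with t h1 h2
      change conj ((isHardy_pt_mul f).toH2.bdry t) * (isHardy_pt_mul g).toH2.bdry t = _
      have := pt_ne_zero t
      rw [h1, h2, map_mul, conj_pt]
      field_simp

theorem bdry_shift (f : H2) : (shift f).bdry =ᵐ[arc] fun t => pt t * f.bdry t :=
  (isHardy_pt_mul f).bdry_toH2

theorem eval_shift (f : H2) (z : 𝔻) : (shift f).eval z = z * f.eval z := by
  rw [H2.eval_eq, cauchy_congr (bdry_shift f), isHardy_pt.cauchy_mul (isHardy_bdry f), Pi.mul_apply,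
    cauchy_pt]
  rfl

/-- The iterated shift `f ↦ zⁿ f`. -/
def shiftIter (n : ℕ) (f : H2) : H2 := shift^[n] f

theorem shiftIter_succ (n : ℕ) (f : H2) : shiftIter (n + 1) f = shift (shiftIter n f) :=
  Function.iterate_succ_apply' _ _ _

theorem bdry_shiftIter (n : ℕ) (f : H2) :
    (shiftIter n f).bdry =ᵐ[arc] fun t => pt t ^ n * f.bdry t := by
  induction n with
  | zero => simp [shiftIter]
  | succ n ih =>
    rw [shiftIter_succ]
    filter_upwards [bdry_shift (shiftIter n f), ih] with t h1 h2
    rw [h1, h2, pow_succ', mul_assoc]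

/-- The Taylor coefficients of an element of `H²`. -/
def H2.coeff (f : H2) (n : ℕ) : ℂ := fourierCoeff f.bdry n

theorem hasSum_eval (f : H2) (z : 𝔻) : HasSum (fun n => f.coeff n * (z : ℂ) ^ n) (f.eval z) :=
  hasSum_cauchy_int (isHardy_bdry f).integrable z

theorem H2.ext_coeff {f g : H2} (h : ∀ n, f.coeff n = g.coeff n) : f = g := by
  apply H2.eval_injective
  funext z
  refine (hasSum_eval f z).unique ?_
  simp only [h]
  exact hasSum_eval g z

theorem H2.eval_zero (f : H2) : f.eval 0 = f.coeff 0 := by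
  rw [H2.coeff, H2.eval_eq, cauchy_zero, fourierCoeff_eq]
  simp

theorem H2.hasSum_sq_coeff (f : H2) : HasSum (fun n => ‖f.coeff n‖ ^ 2) (‖f‖ ^ 2) := by
  have h := hasSum_integral_mul (isHardy_bdry f).1.star (isHardy_bdry f).1
  have h1 : ∫ t, (star f.bdry) t * f.bdry t ∂arc = ((‖f‖ ^ 2 : ℝ) : ℂ) := by
    have h2 := H2.inner_eq f f
    rw [inner_self_eq_norm_sq_to_K] at h2
    push_cast
    exact h2.symm
  rw [h1] at h
  have h3 : ∀ k : ℤ, fourierCoeff (star f.bdry) (-k) * fourierCoeff f.bdry k =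
      ((‖fourierCoeff f.bdry k‖ ^ 2 : ℝ) : ℂ) := fun k => by
    have := fourierCoeff_conj f.bdry (-k)
    rw [neg_neg] at this
    push_cast
    rw [← Complex.conj_mul', ← this]
    rfl
  simp only [h3] at h
  have h4 := Complex.hasSum_ofReal.mp h
  have hinj : Function.Injective ((↑) : ℕ → ℤ) := Nat.cast_injective
  refine (hinj.hasSum_iff ?_).mpr h4
  intro k hk
  rw [(isHardy_bdry f).2 k]
  · simp
  · by_contra h
    exact hk ⟨k.toNat, by omega⟩

/-- The backward shift operator on `H²`. -/
def backshift : H2 →L[ℂ] H2 := ContinuousLinearMap.adjoint shift.toContinuousLinearMap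

theorem inner_backshift_left (f g : H2) : inner ℂ (backshift f) g = (inner ℂ f (shift g) : ℂ) :=
  ContinuousLinearMap.adjoint_inner_left _ _ _

theorem inner_backshift_right (f g : H2) : inner ℂ f (backshift g) = (inner ℂ (shift f) g : ℂ) :=
  ContinuousLinearMap.adjoint_inner_right _ _ _

theorem backshift_shift (f : H2) : backshift (shift f) = f := by
  refine ext_inner_right ℂ fun g => ?_
  rw [inner_backshift_left, LinearIsometry.inner_map_map]

theorem norm_backshift_le (f : H2) : ‖backshift f‖ ≤ ‖f‖ :=
  norm_adjoint_apply_le (H := H2) (R := shift.toContinuousLinearMap)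
    (fun x => (shift.norm_map x).le) f

theorem coeff_eq_inner (f : H2) (n : ℕ) :
    f.coeff n = inner ℂ (isHardy_pow n).toH2 f := by
  rw [H2.coeff, fourierCoeff_eq, H2.inner_eq]
  refine integral_congr_ae ?_
  filter_upwards [(isHardy_pow n).bdry_toH2] with t h
  rw [h, map_pow, conj_pt, zpow_neg, zpow_natCast, inv_pow]

theorem shift_toH2_pow (n : ℕ) : shift (isHardy_pow n).toH2 = (isHardy_pow (n + 1)).toH2 := by
  refine H2.ext_bdry ?_
  filter_upwards [bdry_shift (isHardy_pow n).toH2, (isHardy_pow n).bdry_toH2,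
    (isHardy_pow (n + 1)).bdry_toH2] with t h1 h2 h3
  rw [h1, h2, h3, pow_succ']

theorem coeff_backshift (f : H2) (n : ℕ) : (backshift f).coeff n = f.coeff (n + 1) := by
  rw [coeff_eq_inner, coeff_eq_inner, inner_backshift_right, shift_toH2_pow]

theorem coeff_backshift_pow (f : H2) (m n : ℕ) :
    ((backshift ^ m) f).coeff n = f.coeff (n + m) := by
  induction m generalizing n with
  | zero => simp
  | succ m ih => rw [pow_succ', mul_apply_eq_comp, coeff_backshift, ih, add_assoc, add_comm 1]

theorem coeff_shift_zero (f : H2) : (shift f).coeff 0 = 0 := by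
  rw [← H2.eval_zero, eval_shift]
  simp

theorem coeff_shift_succ (f : H2) (n : ℕ) : (shift f).coeff (n + 1) = f.coeff n := by
  rw [← coeff_backshift, backshift_shift]

theorem shift_backshift {f : H2} (h : f.coeff 0 = 0) : shift (backshift f) = f := by
  refine H2.ext_coeff fun n => ?_
  cases n with
  | zero => rw [coeff_shift_zero, h]
  | succ n => rw [coeff_shift_succ, coeff_backshift]

/-- The squared norm of `S*ⁿ f` is the tail of the convergent series of squared coefficients of `f`.
-/
theorem tendsto_backshift_pow (f : H2) :
    Tendsto (fun n : ℕ => (backshift ^ n) f) atTop (𝓝 0) := by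
  rw [tendsto_zero_iff_norm_tendsto_zero]
  have h : Tendsto (fun n : ℕ => ‖(backshift ^ n) f‖ ^ 2) atTop (𝓝 0) := by
    refine (tendsto_sum_nat_add fun n => ‖f.coeff n‖ ^ 2).congr fun n => ?_
    rw [← ((backshift ^ n) f).hasSum_sq_coeff.tsum_eq]
    simp only [coeff_backshift_pow]
  have h2 := (Real.continuous_sqrt.tendsto _).comp h
  rw [Real.sqrt_zero] at h2
  refine h2.congr fun n => ?_
  rw [Function.comp, Real.sqrt_sq (norm_nonneg _)]

/-! ### Beurling's theorem -/

theorem inner_shiftIter (f θ : H2) (n : ℕ) :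
    inner ℂ f (shiftIter n θ) = fourierCoeff (fun t => θ.bdry t * conj (f.bdry t)) (-n) := by
  rw [H2.inner_eq, fourierCoeff_eq]
  refine integral_congr_ae ?_
  filter_upwards [bdry_shiftIter n θ] with t h
  rw [h, neg_neg, zpow_natCast]
  ring

theorem inner_shiftIter_left (f θ : H2) (n : ℕ) :
    inner ℂ (shiftIter n f) θ = fourierCoeff (fun t => θ.bdry t * conj (f.bdry t)) n := by
  rw [H2.inner_eq, fourierCoeff_eq]
  refine integral_congr_ae ?_
  filter_upwards [bdry_shiftIter n f] with t h
  rw [h, map_mul, map_pow, conj_pt, zpow_neg, zpow_natCast, inv_pow]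
  ring

/-- The inner products of `θ` with `zⁿ θ` are Fourier coefficients of `|θ|²`; the conjugates supply
the opposite frequencies, so `|θ|² - 1` has none left. -/
theorem isInner_of_inner_shiftIter {θ : H2} (hn : ‖θ‖ = 1)
    (h : ∀ n : ℕ, inner ℂ θ (shiftIter (n + 1) θ) = (0 : ℂ)) : IsInner θ := by
  have hm := memLp_bdry θ
  have hi : Integrable (fun t => θ.bdry t * conj (θ.bdry t)) arc := hm.integrable_mul hm.star
  have key : (fun t => θ.bdry t * conj (θ.bdry t) - 1) =ᵐ[arc] 0 := by
    refine ae_eq_zero_of_fourierCoeff (hi.sub (integrable_const _)) fun n => ?_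
    have hs : fourierCoeff (fun t => θ.bdry t * conj (θ.bdry t) - 1) n =
        fourierCoeff (fun t => θ.bdry t * conj (θ.bdry t)) n -
          fourierCoeff (fun t => pt t ^ (0 : ℤ)) n := by
      simp only [fourierCoeff, smul_sub, zpow_zero]
      exact integral_sub (hi.fourier_smul _) ((integrable_const (1 : ℂ)).fourier_smul _)
    rw [hs, fourierCoeff_zpow]
    obtain ⟨m, rfl | rfl⟩ := n.eq_nat_or_neg
    · rw [← inner_shiftIter_left]
      cases m with
      | zero =>
        simp only [shiftIter, Function.iterate_zero, id, inner_self_eq_norm_sq_to_K, hn]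
        simp
      | succ m =>
        rw [← inner_conj_symm, h, map_zero, if_neg (by omega), sub_zero]
    · rw [← inner_shiftIter]
      cases m with
      | zero =>
        simp only [shiftIter, Function.iterate_zero, id, inner_self_eq_norm_sq_to_K, hn]
        simp
      | succ m => rw [h, if_neg (by omega), sub_zero]
  filter_upwards [key] with t ht
  have h1 : ((‖θ.bdry t‖ ^ 2 : ℝ) : ℂ) = 1 := by
    push_cast
    rw [← Complex.mul_conj']
    exact sub_eq_zero.mp ht
  have h2 : ‖θ.bdry t‖ ^ 2 = 1 := by exact_mod_cast h1
  exact (pow_eq_one_iff_of_nonneg (norm_nonneg _) two_ne_zero).mp h2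

theorem modelSpace_zero : modelSpace 0 = ⊤ := by
  rw [eq_top_iff]
  intro f _
  rw [mem_modelSpace_iff (bdry_norm_le_one (Or.inr rfl))]
  refine (isHardy_const 0).congr ?_
  filter_upwards [H2.bdry_zero] with t ht
  simp [ht]

/-- A wandering vector exists: if `E = z E`, each element of `E` could be divided by `z`
indefinitely, so all its Taylor coefficients would vanish. -/
theorem exists_unit_orthogonal_shift {E : Submodule ℂ H2} (hE : IsClosed (E : Set H2))
    (hS : ∀ f ∈ E, shift f ∈ E) (h0 : E ≠ ⊥) :
    ∃ θ ∈ E, ‖θ‖ = 1 ∧ ∀ f ∈ E, inner ℂ θ (shift f) = (0 : ℂ) := by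
  set F := E.map shift.toLinearMap with hF
  have hFE : F ≤ E := by
    rintro _ ⟨f, hf, rfl⟩
    exact hS f hf
  have hFc : IsComplete (F : Set H2) := by
    rw [hF, Submodule.map_coe]
    exact (LinearIsometry.isComplete_image_iff shift (s := (E : Set H2))).mpr hE.isComplete
  have : CompleteSpace F := hFc.completeSpace_coe
  obtain ⟨e, he, hne⟩ : ∃ e ∈ Fᗮ ⊓ E, e ≠ 0 := by
    by_contra! hcon
    have h1 : Fᗮ ⊓ E = ⊥ := (Submodule.eq_bot_iff _).mpr hcon
    have h2 := Submodule.sup_orthogonal_inf_of_hasOrthogonalProjection hFE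
    rw [h1, sup_bot_eq] at h2
    apply h0
    rw [Submodule.eq_bot_iff]
    have h3 : ∀ f ∈ E, f.coeff 0 = 0 ∧ backshift f ∈ E := by
      intro f hf
      rw [← h2] at hf
      obtain ⟨g, hg, rfl⟩ := hf
      exact ⟨coeff_shift_zero g, by
        change backshift (shift g) ∈ E
        rwa [backshift_shift]⟩
    have h4 : ∀ n : ℕ, ∀ f ∈ E, (backshift ^ n) f ∈ E := by
      intro n
      induction n with
      | zero => intro f hf; simpa using hf
      | succ n ih =>
        intro f hf
        rw [pow_succ', mul_apply_eq_comp]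
        exact (h3 _ (ih f hf)).2
    intro f hf
    refine H2.ext_coeff fun n => ?_
    have h5 := (h3 _ (h4 n f hf)).1
    have h6 : (0 : H2).coeff n = 0 := by rw [coeff_eq_inner, inner_zero_right]
    rwa [coeff_backshift_pow, zero_add, ← h6] at h5
  refine ⟨((‖e‖⁻¹ : ℝ) : ℂ) • e, E.smul_mem _ he.2, ?_, fun f hf => ?_⟩
  · rw [norm_smul, norm_real, norm_inv, norm_norm, inv_mul_cancel₀ (norm_ne_zero_iff.mpr hne)]
  · have h1 : inner ℂ e (shift f) = (0 : ℂ) :=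
      (Submodule.mem_orthogonal' _ _).mp he.1 _ ⟨f, hf, rfl⟩
    refine (inner_smul_left (𝕜 := ℂ) e (shift f) _).trans ?_
    rw [h1, mul_zero]

/-- Beurling's theorem: the closed backward shift invariant subspaces are the model spaces. -/
theorem exists_eq_modelSpace {K : Submodule ℂ H2} (hK : IsClosed (K : Set H2))
    (hS : ∀ f ∈ K, backshift f ∈ K) : ∃ θ : H2, (IsInner θ ∨ θ = 0) ∧ K = modelSpace θ := by
  have : CompleteSpace K := hK.completeSpace_coe
  by_cases h0 : Kᗮ = ⊥
  · refine ⟨0, Or.inr rfl, ?_⟩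
    rw [modelSpace_zero]
    exact (Submodule.orthogonal_eq_bot_iff).mp h0
  have hSE : ∀ f ∈ Kᗮ, shift f ∈ Kᗮ := by
    intro f hf
    rw [Submodule.mem_orthogonal] at hf ⊢
    intro g hg
    rw [← inner_backshift_left]
    exact hf _ (hS g hg)
  obtain ⟨θ, hθ, hn, ho⟩ := exists_unit_orthogonal_shift (Submodule.isClosed_orthogonal K) hSE h0
  have hit : ∀ n : ℕ, ∀ f ∈ Kᗮ, shiftIter n f ∈ Kᗮ := by
    intro n f hf
    induction n with
    | zero => exact hf
    | succ n ih =>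
      rw [shiftIter_succ]
      exact hSE _ ih
  have hin : IsInner θ := isInner_of_inner_shiftIter hn fun n => by
    rw [shiftIter_succ]
    exact ho _ (hit n θ hθ)
  have hb := bdry_norm_le_one (Or.inl hin)
  have hq : ∀ f : H2, MemLp (fun t => θ.bdry t * conj (f.bdry t)) 2 arc := fun f =>
    memLp_bdd_mul (isHardy_bdry θ).1.1 hb (memLp_bdry f).star
  have hiff : ∀ f, f ∈ modelSpace θ ↔ ∀ n : ℕ, inner ℂ f (shiftIter n θ) = (0 : ℂ) := by
    intro f
    rw [mem_modelSpace_iff hb, isHardy_inv_pt_mul_iff (hq f)]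
    simp only [inner_shiftIter]
  have hle : K ≤ modelSpace θ := fun f hf => (hiff f).mpr fun n =>
    (Submodule.mem_orthogonal _ _).mp (hit n θ hθ) f hf
  refine ⟨θ, Or.inl hin, le_antisymm hle fun f hf => ?_⟩
  obtain ⟨f₁, hf₁, f₂, hf₂, rfl⟩ := K.exists_add_mem_mem_orthogonal f
  have hf₂' : f₂ ∈ modelSpace θ := by
    have := (modelSpace θ).sub_mem hf (hle hf₁)
    rwa [add_sub_cancel_left] at this
  -- Frequencies `≤ 0` vanish because `f₂ ∈ K_θ`; positive ones vanish because `θ` is orthogonal to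
  -- `z Kᗮ`, which contains `zᵐ⁺¹ f₂`.
  have hz : (fun t => θ.bdry t * conj (f₂.bdry t)) =ᵐ[arc] 0 := by
    refine ae_eq_zero_of_fourierCoeff ((hq f₂).integrable (by norm_num)) fun n => ?_
    obtain ⟨m, rfl | rfl⟩ := n.eq_nat_or_neg
    · cases m with
      | zero =>
        rw [← (hiff f₂).mp hf₂' 0, inner_shiftIter]
        rfl
      | succ m =>
        rw [← inner_shiftIter_left, shiftIter_succ, ← inner_conj_symm, ho _ (hit m f₂ hf₂),
          map_zero]
    · rw [← inner_shiftIter]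
      exact (hiff f₂).mp hf₂' m
  have : f₂ = 0 := by
    refine H2.ext_bdry ?_
    filter_upwards [hz, hin, H2.bdry_zero] with t h1 h2 h3
    rw [h3]
    have h4 : θ.bdry t ≠ 0 := norm_ne_zero_iff.mp (by rw [h2]; exact one_ne_zero)
    simpa [h4] using h1
  rw [this, add_zero]
  exact hf₁

/-! ### Point evaluations and Taylor coefficients -/

theorem H2.eval_add (f g : H2) (z : 𝔻) : (f + g).eval z = f.eval z + g.eval z := by
  rw [H2.eval_eq, cauchy_congr (H2.bdry_add f g),
    cauchy_add (isHardy_bdry f).integrable (isHardy_bdry g).integrable]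
  rfl

theorem H2.inner_smul_right (c : ℂ) (f g : H2) : inner ℂ f (c • g) = c * (inner ℂ f g : ℂ) :=
  _root_.inner_smul_right f g c

theorem H2.inner_smul_left (c : ℂ) (f g : H2) : inner ℂ (c • f) g = conj c * (inner ℂ f g : ℂ) :=
  _root_.inner_smul_left f g c

theorem H2.eval_smul (c : ℂ) (f : H2) (z : 𝔻) : (c • f).eval z = c * f.eval z := by
  rw [H2.eval_eq, cauchy_congr (H2.bdry_smul c f), cauchy_const_mul]
  rfl

theorem H2.eval_zero_apply (z : 𝔻) : (0 : H2).eval z = 0 := by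
  have := H2.eval_smul 0 0 z
  rwa [zero_smul, zero_mul] at this

theorem eval_eq_inner (f : H2) (z : 𝔻) : f.eval z = inner ℂ (isHardy_szego z).toH2 f := by
  rw [H2.inner_eq, H2.eval_eq, cauchy]
  refine integral_congr_ae ?_
  filter_upwards [(isHardy_szego z).bdry_toH2] with t h
  rw [h, szego, div_eq_mul_inv, mul_comm, map_inv₀, map_sub, map_mul, conj_conj, map_one,
    mul_comm (z : ℂ)]

theorem continuous_eval (z : 𝔻) : Continuous fun f : H2 => f.eval z := by
  simp only [eval_eq_inner]
  exact (innerSL ℂ (isHardy_szego z).toH2).continuous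

theorem continuous_coeff (n : ℕ) : Continuous fun f : H2 => f.coeff n := by
  simp only [coeff_eq_inner]
  exact (innerSL ℂ (isHardy_pow n).toH2).continuous

theorem H2.coeff_add (f g : H2) (n : ℕ) : (f + g).coeff n = f.coeff n + g.coeff n := by
  simp only [coeff_eq_inner]
  exact inner_add_right _ _ _

theorem H2.coeff_smul (c : ℂ) (f : H2) (n : ℕ) : (c • f).coeff n = c * f.coeff n := by
  simp only [coeff_eq_inner]
  exact H2.inner_smul_right _ _ _

theorem H2.coeff_zero (n : ℕ) : (0 : H2).coeff n = 0 := by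
  rw [coeff_eq_inner]
  exact inner_zero_right _

/-- There is an element of `H²` with given square summable coefficients. -/
theorem exists_coeff_eq {c : ℕ → ℂ} (hc : Summable fun n => ‖c n‖ ^ 2) :
    ∃ f : H2, ∀ n, f.coeff n = c n := by
  let d : ℤ → ℂ := fun n => if n < 0 then 0 else c n.toNat
  have hinj : Function.Injective ((↑) : ℕ → ℤ) := Nat.cast_injective
  have hd : Summable fun n => ‖d n‖ ^ 2 := by
    refine (hinj.summable_iff ?_).mp (hc.congr fun n => ?_)
    · intro k hk
      have : k < 0 := by
        by_contra h
        exact hk ⟨k.toNat, by omega⟩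
      simp [d, this]
    · simp only [d, Function.comp]
      rw [if_neg (by omega), Int.toNat_natCast]
  have hm : Memℓp d 2 := memℓp_gen (by simpa using hd)
  let F : Lp ℂ 2 arc := fourierBasis.repr.symm ⟨d, hm⟩
  have hF : ∀ n : ℤ, fourierCoeff (F : Torus → ℂ) n = d n := fun n => by
    rw [← fourierBasis_repr]
    simp [F]
  refine ⟨⟨F, fun n hn => by rw [hF]; simp [d, hn]⟩, fun n => (hF n).trans ?_⟩
  simp only [d]
  rw [if_neg (by omega), Int.toNat_natCast]

/-- The element of `H²` with given square summable coefficients. -/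
def ofCoeff {c : ℕ → ℂ} (hc : Summable fun n => ‖c n‖ ^ 2) : H2 := (exists_coeff_eq hc).choose

theorem coeff_ofCoeff {c : ℕ → ℂ} (hc : Summable fun n => ‖c n‖ ^ 2) (n : ℕ) :
    (ofCoeff hc).coeff n = c n := (exists_coeff_eq hc).choose_spec n

/-! ### Hitt's theorem on nearly backward shift invariant subspaces -/

/-- The extremal vector of a nearly invariant subspace. -/
structure IsExtremal (u : H2) (N : Submodule ℂ H2) : Prop where
  mem : u ∈ N
  norm_eq_one : ‖u‖ = 1
  coeff_ne : u.coeff 0 ≠ 0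
  orthogonal : ∀ f ∈ N, f.coeff 0 = 0 → inner ℂ u f = (0 : ℂ)

/-- Some element of `N` does not vanish at 0, since otherwise near invariance would allow repeated
division by `z` and force `N = 0`. Its component orthogonal to the elements of `N` vanishing at 0,
normalized, is extremal. -/
theorem exists_isExtremal {N : Submodule ℂ H2} (hN : IsClosed (N : Set H2))
    (hnear : ∀ g, shift g ∈ N → g ∈ N) (h0 : N ≠ ⊥) : ∃ u, IsExtremal u N := by
  obtain ⟨f, hf, hf0⟩ : ∃ f ∈ N, f.coeff 0 ≠ 0 := by
    by_contra! hcon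
    apply h0
    rw [Submodule.eq_bot_iff]
    have h1 : ∀ n : ℕ, ∀ f ∈ N, (backshift ^ n) f ∈ N := by
      intro n f hf
      induction n with
      | zero => simpa using hf
      | succ n ih =>
        rw [pow_succ', mul_apply_eq_comp]
        exact hnear _ (by rwa [shift_backshift (hcon _ ih)])
    intro f hf
    refine H2.ext_coeff fun n => ?_
    have h2 := hcon _ (h1 n f hf)
    rwa [coeff_backshift_pow, zero_add, ← H2.coeff_zero n] at h2
  let F : Submodule ℂ H2 :=
    { carrier := {g | g ∈ N ∧ g.coeff 0 = 0}
      zero_mem' := ⟨N.zero_mem, H2.coeff_zero 0⟩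
      add_mem' := fun {x y} hx hy => ⟨N.add_mem hx.1 hy.1, by
        rw [H2.coeff_add, hx.2, hy.2, add_zero]⟩
      smul_mem' := fun c x hx => ⟨N.smul_mem c hx.1, by rw [H2.coeff_smul, hx.2, mul_zero]⟩ }
  have hF : IsClosed (F : Set H2) :=
    hN.inter (isClosed_singleton.preimage (continuous_coeff 0))
  have : CompleteSpace F := hF.completeSpace_coe
  obtain ⟨f₁, hf₁, f₂, hf₂, rfl⟩ := F.exists_add_mem_mem_orthogonal f
  have hm : f₂ ∈ N := (N.add_mem_iff_right hf₁.1).mp hf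
  have hc : f₂.coeff 0 ≠ 0 := by rwa [H2.coeff_add, hf₁.2, zero_add] at hf0
  have hne : f₂ ≠ 0 := by
    rintro rfl
    exact hc (H2.coeff_zero 0)
  have hne' : ‖f₂‖ ≠ 0 := norm_ne_zero_iff.mpr hne
  refine ⟨((‖f₂‖⁻¹ : ℝ) : ℂ) • f₂, N.smul_mem _ hm, ?_, ?_, fun g hg hg0 => ?_⟩
  · rw [norm_smul, norm_real, norm_inv, norm_norm, inv_mul_cancel₀ hne']
  · rw [H2.coeff_smul]
    exact mul_ne_zero (by exact_mod_cast inv_ne_zero hne') hc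
  · have h1 : inner ℂ f₂ g = (0 : ℂ) := (Submodule.mem_orthogonal' _ _).mp hf₂ g ⟨hg, hg0⟩
    rw [H2.inner_smul_left, h1, mul_zero]

/-- The operator `f ↦ S* (f - ⟪u, f⟫ u)`. -/
def reducedShift (u : H2) : H2 →L[ℂ] H2 :=
  backshift - (innerSL ℂ u).smulRight (backshift u)

theorem reducedShift_apply (u f : H2) :
    reducedShift u f = backshift f - (inner ℂ u f : ℂ) • backshift u := rfl

theorem reducedShift_apply' (u f : H2) :
    reducedShift u f = backshift (f - (inner ℂ u f : ℂ) • u) := by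
  rw [reducedShift_apply, map_sub, map_smul]

theorem norm_sub_inner_smul_sq {u : H2} (hu : ‖u‖ = 1) (f : H2) :
    ‖f - (inner ℂ u f : ℂ) • u‖ ^ 2 = ‖f‖ ^ 2 - ‖(inner ℂ u f : ℂ)‖ ^ 2 := by
  have h1 : (inner ℂ f ((inner ℂ u f : ℂ) • u) : ℂ) = ((‖(inner ℂ u f : ℂ)‖ ^ 2 : ℝ) : ℂ) := by
    rw [H2.inner_smul_right, ← inner_conj_symm f u, Complex.mul_conj']
    push_cast
    rfl
  have h2 := norm_sub_sq (𝕜 := ℂ) f ((inner ℂ u f : ℂ) • u)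
  rw [h1, norm_smul, hu, mul_one] at h2
  have h3 : RCLike.re (((‖(inner ℂ u f : ℂ)‖ ^ 2 : ℝ) : ℂ)) = ‖(inner ℂ u f : ℂ)‖ ^ 2 :=
    Complex.ofReal_re _
  rw [h3] at h2
  linarith

theorem norm_reducedShift_le {u : H2} (hu : ‖u‖ = 1) (f : H2) : ‖reducedShift u f‖ ≤ ‖f‖ := by
  rw [reducedShift_apply']
  refine (norm_backshift_le _).trans ?_
  refine le_of_sq_le_sq ?_ (norm_nonneg _)
  rw [norm_sub_inner_smul_sq hu]
  linarith [sq_nonneg ‖(inner ℂ u f : ℂ)‖]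

theorem inner_self_eq_one {u : H2} (hu : ‖u‖ = 1) : inner ℂ u u = (1 : ℂ) := by
  rw [inner_self_eq_norm_sq_to_K, hu]
  simp

theorem reducedShift_self {u : H2} (hu : ‖u‖ = 1) : reducedShift u u = 0 := by
  rw [reducedShift_apply', inner_self_eq_one hu, one_smul, sub_self, map_zero]

theorem inner_backshift_pow (f g : H2) (n : ℕ) :
    inner ℂ f ((backshift ^ n) g) = (inner ℂ (shiftIter n f) g : ℂ) := by
  induction n generalizing g with
  | zero => simp [shiftIter]
  | succ n ih =>
    rw [pow_succ, mul_apply_eq_comp, ih, inner_backshift_right, shiftIter_succ]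

theorem tendsto_reducedShift_pow {u : H2} (hu : ‖u‖ = 1) (f : H2) :
    Tendsto (fun n : ℕ => ‖(reducedShift u ^ n) f‖) atTop (𝓝 0) := by
  have hm := memLp_bdry u
  have e : ∀ t, ((‖u.bdry t‖ ^ 2 : ℝ) : ℂ) = u.bdry t * conj (u.bdry t) := fun t => by
    rw [Complex.mul_conj']
    push_cast
    rfl
  -- The density is `|u|²`: since `S*` is adjoint to multiplication by `z`, `⟪u, S*ʲ u⟫ = ⟪zʲ u, u⟫`
  -- is its moment against `ζ̄ʲ`.
  refine tendsto_pow_rankOne_perturbation (H := H2) (T := backshift) (R := reducedShift u) (u := u)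
    tendsto_backshift_pow (norm_reducedShift_le hu) (reducedShift_apply u) (reducedShift_self hu)
    (w := fun t => ‖u.bdry t‖ ^ 2) hm.norm.integrable_sq (fun t => by positivity) ?_ (fun j => ?_) f
  · have h := H2.inner_eq u u
    rw [inner_self_eq_one hu] at h
    have h2 : ((∫ t, ‖u.bdry t‖ ^ 2 ∂arc : ℝ) : ℂ) = 1 := by
      rw [h, ← integral_complex_ofReal]
      refine integral_congr_ae (ae_of_all _ fun t => ?_)
      simp only [e, mul_comm]
    exact_mod_cast h2
  · rw [inner_backshift_pow, H2.inner_eq]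
    refine integral_congr_ae ?_
    filter_upwards [bdry_shiftIter j u] with t h
    rw [h, e, map_mul, map_pow]
    ring

/-! ### Division by the extremal vector -/

namespace IsExtremal

variable {u : H2} {N : Submodule ℂ H2}

/-- With `c = f(0) / u(0)`, the difference `f - c u` vanishes at 0 and is therefore orthogonal to
`u`, which forces `c = ⟪u, f⟫`. -/
theorem coeff_sub (hu : IsExtremal u N) {f : H2} (hf : f ∈ N) :
    (f - (inner ℂ u f : ℂ) • u).coeff 0 = 0 := by
  set c := f.coeff 0 / u.coeff 0 with hc
  have h1 : (f + (-c) • u).coeff 0 = 0 := by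
    rw [H2.coeff_add, H2.coeff_smul, hc, neg_mul, div_mul_cancel₀ _ hu.coeff_ne, add_neg_cancel]
  have h2 := hu.orthogonal _ (N.add_mem hf (N.smul_mem _ hu.mem)) h1
  rw [inner_add_right, H2.inner_smul_right, inner_self_eq_one hu.norm_eq_one, mul_one,
    ← sub_eq_add_neg, sub_eq_zero] at h2
  rwa [h2, sub_eq_add_neg, ← neg_smul]

theorem shift_reducedShift (hu : IsExtremal u N) {f : H2} (hf : f ∈ N) :
    shift (reducedShift u f) = f - (inner ℂ u f : ℂ) • u := by
  rw [reducedShift_apply', shift_backshift (hu.coeff_sub hf)]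

theorem reducedShift_mem (hu : IsExtremal u N) (hnear : ∀ g, shift g ∈ N → g ∈ N) {f : H2}
    (hf : f ∈ N) : reducedShift u f ∈ N :=
  hnear _ (by
    rw [hu.shift_reducedShift hf]
    exact N.sub_mem hf (N.smul_mem _ hu.mem))

theorem reducedShift_pow_mem (hu : IsExtremal u N) (hnear : ∀ g, shift g ∈ N → g ∈ N) {f : H2}
    (hf : f ∈ N) (n : ℕ) : (reducedShift u ^ n) f ∈ N := by
  induction n with
  | zero => simpa using hf
  | succ n ih =>
    rw [pow_succ', mul_apply_eq_comp]
    exact hu.reducedShift_mem hnear ih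

/-- Pythagoras at each step of `f = ⟪u, f⟫ u + z R f`, together with the isometry of the shift. -/
theorem norm_sq_eq (hu : IsExtremal u N) (hnear : ∀ g, shift g ∈ N → g ∈ N) {f : H2}
    (hf : f ∈ N) (n : ℕ) : ∑ j ∈ Finset.range n, ‖(inner ℂ u ((reducedShift u ^ j) f) : ℂ)‖ ^ 2 =
      ‖f‖ ^ 2 - ‖(reducedShift u ^ n) f‖ ^ 2 := by
  induction n with
  | zero => simp
  | succ n ih =>
    have h := hu.shift_reducedShift (hu.reducedShift_pow_mem hnear hf n)
    have h1 := norm_sub_inner_smul_sq hu.norm_eq_one ((reducedShift u ^ n) f)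
    rw [← h, LinearIsometry.norm_map] at h1
    rw [Finset.sum_range_succ, ih, pow_succ' (reducedShift u), mul_apply_eq_comp, h1]
    ring

/-- Strong convergence `Rⁿ f → 0` removes the remainder; this equality is what makes division by `u`
isometric. -/
theorem hasSum_norm_sq (hu : IsExtremal u N) (hnear : ∀ g, shift g ∈ N → g ∈ N) {f : H2}
    (hf : f ∈ N) : HasSum (fun j : ℕ => ‖(inner ℂ u ((reducedShift u ^ j) f) : ℂ)‖ ^ 2)
      (‖f‖ ^ 2) := by
  rw [hasSum_iff_tendsto_nat_of_nonneg fun _ => by positivity]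
  simp only [hu.norm_sq_eq hnear hf]
  simpa using ((tendsto_reducedShift_pow hu.norm_eq_one f).pow 2).const_sub (‖f‖ ^ 2)

/-- The quotient map `f ↦ f / u` on a nearly invariant subspace with extremal vector `u`. -/
def quotientMap (hu : IsExtremal u N) (hnear : ∀ g, shift g ∈ N → g ∈ N) : N →ₗᵢ[ℂ] H2 where
  toFun f := ofCoeff (hu.hasSum_norm_sq hnear f.2).summable
  map_add' f g := H2.ext_coeff fun n => by
    rw [H2.coeff_add]
    simp only [coeff_ofCoeff]
    rw [Submodule.coe_add, map_add, inner_add_right]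
  map_smul' c f := H2.ext_coeff fun n => by
    rw [H2.coeff_smul]
    simp only [coeff_ofCoeff, RingHom.id_apply]
    rw [Submodule.coe_smul, map_smul, H2.inner_smul_right]
  norm_map' f := by
    have h1 := (ofCoeff (hu.hasSum_norm_sq hnear f.2).summable).hasSum_sq_coeff
    simp only [coeff_ofCoeff] at h1
    have h2 := h1.unique (hu.hasSum_norm_sq hnear f.2)
    exact (pow_left_inj₀ (norm_nonneg _) (norm_nonneg _) two_ne_zero).mp h2

theorem coeff_quotientMap (hu : IsExtremal u N) (hnear : ∀ g, shift g ∈ N → g ∈ N) (f : N)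
    (n : ℕ) : (hu.quotientMap hnear f).coeff n = inner ℂ u ((reducedShift u ^ n) (f : H2)) :=
  coeff_ofCoeff (hu.hasSum_norm_sq hnear f.2).summable n

theorem eval_eq_sum (hu : IsExtremal u N) (hnear : ∀ g, shift g ∈ N → g ∈ N) {f : H2}
    (hf : f ∈ N) (n : ℕ) (z : 𝔻) : f.eval z =
      (∑ j ∈ Finset.range n, (inner ℂ u ((reducedShift u ^ j) f) : ℂ) * (z : ℂ) ^ j) * u.eval z +
        (z : ℂ) ^ n * ((reducedShift u ^ n) f).eval z := by
  induction n with
  | zero => simp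
  | succ n ih =>
    have h := hu.shift_reducedShift (hu.reducedShift_pow_mem hnear hf n)
    have h1 : (reducedShift u ^ n) f = shift ((reducedShift u ^ (n + 1)) f) +
        (inner ℂ u ((reducedShift u ^ n) f) : ℂ) • u := by
      rw [pow_succ' (reducedShift u), mul_apply_eq_comp, h, sub_add_cancel]
    have h2 := congrArg (fun g : H2 => g.eval z) h1
    simp only [H2.eval_add, H2.eval_smul, eval_shift] at h2
    rw [ih, Finset.sum_range_succ, h2]
    ring

/-- The remainder `zⁿ (Rⁿ f)(z)` in the finite expansion tends to 0, because point evaluations are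
continuous. -/
theorem eval_eq_mul (hu : IsExtremal u N) (hnear : ∀ g, shift g ∈ N → g ∈ N) (f : N) :
    (f : H2).eval = u.eval * (hu.quotientMap hnear f).eval := by
  funext z
  have h1 := (hasSum_eval (hu.quotientMap hnear f) z).tendsto_sum_nat
  simp only [coeff_quotientMap] at h1
  have h2 : Tendsto (fun n : ℕ => (z : ℂ) ^ n * ((reducedShift u ^ n) (f : H2)).eval z) atTop
      (𝓝 0) := by
    have h3 : Tendsto (fun n : ℕ => ((reducedShift u ^ n) (f : H2)).eval z) atTop (𝓝 0) := by
      have h4 := ((continuous_eval z).tendsto 0).comp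
        (tendsto_zero_iff_norm_tendsto_zero.mpr (tendsto_reducedShift_pow hu.norm_eq_one (f : H2)))
      rwa [H2.eval_zero_apply] at h4
    have h5 := (tendsto_pow_atTop_nhds_zero_of_norm_lt_one z.norm_lt_one).mul h3
    rwa [zero_mul] at h5
  have h6 := (h1.mul_const (u.eval z)).add h2
  rw [add_zero] at h6
  rw [Pi.mul_apply, mul_comm (u.eval z)]
  exact tendsto_nhds_unique (tendsto_const_nhds.congr fun n => hu.eval_eq_sum hnear f.2 n z) h6

/-- Makes the range of the quotient map `S*`-invariant, as Beurling's theorem requires. -/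
theorem backshift_quotientMap (hu : IsExtremal u N) (hnear : ∀ g, shift g ∈ N → g ∈ N) (f : N) :
    backshift (hu.quotientMap hnear f) =
      hu.quotientMap hnear ⟨reducedShift u f, hu.reducedShift_mem hnear f.2⟩ := by
  refine H2.ext_coeff fun n => ?_
  rw [coeff_backshift, coeff_quotientMap, coeff_quotientMap, pow_succ, mul_apply_eq_comp]

end IsExtremal

theorem modelSpace_const_one : modelSpace (isHardy_const 1).toH2 = ⊥ := by
  rw [Submodule.eq_bot_iff]
  intro f hf
  have hmem : f ∈ multiples (isHardy_const 1).toH2 := ⟨f, by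
    filter_upwards [(isHardy_const 1).bdry_toH2] with t h
    rw [h, one_mul]⟩
  exact inner_self_eq_zero.mp ((Submodule.mem_orthogonal _ _).mp hf f hmem)

theorem fns_bot : fns ⊥ = {0} := by
  rw [fns, Submodule.bot_coe, Set.image_singleton, Set.singleton_eq_singleton_iff]
  funext z
  exact H2.eval_zero_apply z

/-- Hitt's theorem: a closed nearly backward shift invariant subspace has the form `u K_θ`. -/
theorem exists_fns_eq_mulSet_modelSpace {N : Submodule ℂ H2} (hN : IsClosed (N : Set H2))
    (hnear : ∀ g, shift g ∈ N → g ∈ N) :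
    ∃ u θ : H2, (IsInner θ ∨ θ = 0) ∧ u.eval 0 ≠ 0 ∧ IsIsometricMultiplier u (modelSpace θ) ∧
      fns N = mulSet u.eval (fns (modelSpace θ)) := by
  by_cases h0 : N = ⊥
  · refine ⟨(isHardy_const 1).toH2, (isHardy_const 1).toH2, Or.inl ?_, ?_, ?_, ?_⟩
    · filter_upwards [(isHardy_const 1).bdry_toH2] with t h
      rw [h, norm_one]
    · rw [IsHardy.eval_toH2, cauchy_const]
      exact one_ne_zero
    · rw [modelSpace_const_one]
      intro f hf
      rw [Submodule.mem_bot] at hf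
      subst hf
      refine ⟨0, ?_, rfl⟩
      funext z
      rw [Pi.mul_apply, H2.eval_zero_apply, mul_zero]
    · rw [modelSpace_const_one, h0, fns_bot, mulSet, Set.image_singleton, mul_zero]
  obtain ⟨u, hu⟩ := exists_isExtremal hN hnear h0
  set J := hu.quotientMap hnear with hJ
  have : CompleteSpace N := hN.completeSpace_coe
  have hcl : IsClosed (LinearMap.range J.toLinearMap : Set H2) := by
    rw [LinearMap.coe_range]
    exact J.isometry.isClosedEmbedding.isClosed_range
  obtain ⟨θ, hθ, hK⟩ := exists_eq_modelSpace hcl (by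
    rintro _ ⟨f, rfl⟩
    exact ⟨_, (hu.backshift_quotientMap hnear f).symm⟩)
  refine ⟨u, θ, hθ, by rw [H2.eval_zero]; exact hu.coeff_ne, ?_, ?_⟩
  · rw [← hK]
    rintro _ ⟨f, rfl⟩
    exact ⟨f, hu.eval_eq_mul hnear f, (J.norm_map f).symm⟩
  · rw [← hK]
    ext F
    simp only [fns, mulSet, Set.mem_image, SetLike.mem_coe, exists_exists_and_eq_and]
    constructor
    · rintro ⟨f, hf, rfl⟩
      exact ⟨J ⟨f, hf⟩, ⟨_, rfl⟩, (hu.eval_eq_mul hnear ⟨f, hf⟩).symm⟩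
    · rintro ⟨_, ⟨f, rfl⟩, rfl⟩
      exact ⟨f, f.2, hu.eval_eq_mul hnear f⟩

/-! ### Converse of Hitt's theorem -/

theorem backshift_mem_modelSpace {θ f : H2} (hf : f ∈ modelSpace θ) :
    backshift f ∈ modelSpace θ := by
  rw [modelSpace, Submodule.mem_orthogonal'] at hf ⊢
  rintro g ⟨h, hh⟩
  refine (inner_backshift_left f g).trans (hf _ ⟨shift h, ?_⟩)
  filter_upwards [hh, bdry_shift g, bdry_shift h] with t h1 h2 h3
  rw [h2, h3, h1]
  ring

/-- Multiplication by `u` as an isometry. -/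
def IsIsometricMultiplier.toIsometry {u : H2} {K : Submodule ℂ H2}
    (h : IsIsometricMultiplier u K) : K →ₗᵢ[ℂ] H2 where
  toFun f := (h f f.2).choose
  map_add' f g := H2.eval_injective (by
    funext z
    rw [H2.eval_add, (h f f.2).choose_spec.1, (h g g.2).choose_spec.1,
      (h _ (f + g).2).choose_spec.1]
    simp only [Pi.mul_apply, Submodule.coe_add, H2.eval_add]
    ring)
  map_smul' c f := H2.eval_injective (by
    funext z
    rw [RingHom.id_apply, H2.eval_smul, (h f f.2).choose_spec.1, (h _ (c • f).2).choose_spec.1]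
    simp only [Pi.mul_apply, Submodule.coe_smul, H2.eval_smul]
    ring)
  norm_map' f := (h f f.2).choose_spec.2

theorem IsIsometricMultiplier.eval_toIsometry {u : H2} {K : Submodule ℂ H2}
    (h : IsIsometricMultiplier u K) (f : K) :
    (h.toIsometry f).eval = u.eval * (f : H2).eval := (h f f.2).choose_spec.1

/-- An isometric image of a complete space is closed. If `z g = u k` with `k ∈ K_θ`, then `u(0) ≠ 0`
gives `k(0) = 0`, so `k = z S* k` and `g = u S* k` with `S* k ∈ K_θ`. -/
theorem isClosed_and_nearlyInvariant {N : Submodule ℂ H2} {u θ : H2} (hu : u.eval 0 ≠ 0)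
    (h : IsIsometricMultiplier u (modelSpace θ))
    (hN : fns N = mulSet u.eval (fns (modelSpace θ))) :
    IsClosed (N : Set H2) ∧ ∀ g, shift g ∈ N → g ∈ N := by
  have : CompleteSpace (modelSpace θ) :=
    (Submodule.isClosed_orthogonal (multiples θ)).completeSpace_coe
  have hmem : ∀ f, f ∈ N ↔ ∃ k : modelSpace θ, h.toIsometry k = f := by
    intro f
    have h1 : f ∈ N ↔ f.eval ∈ fns N := by
      constructor
      · intro hf
        exact ⟨f, hf, rfl⟩
      · rintro ⟨g, hg, e⟩
        rwa [← H2.eval_injective e]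
    rw [h1, hN]
    constructor
    · rintro ⟨_, ⟨k, hk, rfl⟩, e⟩
      exact ⟨⟨k, hk⟩, H2.eval_injective ((h.eval_toIsometry _).trans e)⟩
    · rintro ⟨k, rfl⟩
      exact ⟨_, ⟨k, k.2, rfl⟩, (h.eval_toIsometry _).symm⟩
  constructor
  · have : (N : Set H2) = Set.range h.toIsometry := by
      ext f
      exact hmem f
    rw [this]
    exact h.toIsometry.isometry.isClosedEmbedding.isClosed_range
  · intro g hg
    obtain ⟨k, hk⟩ := (hmem _).mp hg
    have e1 : (shift g).eval = u.eval * (k : H2).eval := by rw [← hk, h.eval_toIsometry]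
    have hk0 : (k : H2).coeff 0 = 0 := by
      have := congrFun e1 0
      rw [eval_shift, UnitDisc.coe_zero, zero_mul, Pi.mul_apply, H2.eval_zero (k : H2)] at this
      exact (mul_eq_zero.mp this.symm).resolve_left hu
    refine (hmem g).mpr ⟨⟨backshift k, backshift_mem_modelSpace k.2⟩, ?_⟩
    apply shift.injective
    apply H2.eval_injective
    rw [e1]
    funext z
    have e2 := eval_shift (backshift (k : H2)) z
    rw [shift_backshift hk0] at e2
    rw [eval_shift, h.eval_toIsometry, Pi.mul_apply, Pi.mul_apply, e2]
    ring

/-! ### Transfer along the automorphism -/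

theorem compAut_add (lam : Circle) (a : 𝔻) (f g : H2) :
    compAut lam a (f + g) = compAut lam a f + compAut lam a g := H2.eval_injective (by
  funext z
  rw [H2.eval_add]
  simp only [eval_compAut, Function.comp, H2.eval_add])

theorem compAut_smul (lam : Circle) (a : 𝔻) (c : ℂ) (f : H2) :
    compAut lam a (c • f) = c • compAut lam a f := H2.eval_injective (by
  funext z
  rw [H2.eval_smul]
  simp only [eval_compAut, Function.comp, H2.eval_smul])

/-- The composition operator `C_ψ` as a linear map. -/
def compAutLin (lam : Circle) (a : 𝔻) : H2 →ₗ[ℂ] H2 where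
  toFun := compAut lam a
  map_add' := compAut_add lam a
  map_smul' := compAut_smul lam a

/-- Closed graph theorem: point evaluations are continuous and separate `H²`, so they identify the
limit. -/
theorem continuous_compAut (lam : Circle) (a : 𝔻) : Continuous (compAut lam a) := by
  refine LinearMap.continuous_of_seq_closed_graph (𝕜 := ℂ) (E := H2) (F := H2)
    (g := compAutLin lam a) fun v x y hx hy => H2.eval_injective ?_
  funext z
  refine tendsto_nhds_unique (((continuous_eval z).tendsto y).comp hy) ?_
  change Tendsto _ atTop (𝓝 ((compAut lam a x).eval z))
  rw [eval_compAut]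
  refine (((continuous_eval (aut lam a z)).tendsto x).comp hx).congr fun n => ?_
  change _ = (compAut lam a (v n)).eval z
  rw [eval_compAut]
  rfl

/-- The preimage of a subspace under `C_ψ`. -/
def compPreimage (lam : Circle) (a : 𝔻) (M : Submodule ℂ H2) : Submodule ℂ H2 where
  carrier := {f | compAut lam a f ∈ M}
  zero_mem' := by
    have h := (compAutLin lam a).map_zero
    change compAut lam a 0 = 0 at h
    rw [Set.mem_ofPred_eq, h]
    exact M.zero_mem
  add_mem' {f g} hf hg := by
    rw [Set.mem_ofPred_eq, compAut_add]
    exact M.add_mem hf hg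
  smul_mem' c f hf := by
    rw [Set.mem_ofPred_eq, compAut_smul]
    exact M.smul_mem c hf

theorem mem_compPreimage {lam : Circle} {a : 𝔻} {M : Submodule ℂ H2} {f : H2} :
    f ∈ compPreimage lam a M ↔ compAut lam a f ∈ M := Iff.rfl

/-- The symbol is bounded and analytic, so the projection acts trivially on `ψ g`. -/
theorem eval_toeplitzAut (lam : Circle) (a : 𝔻) (g : H2) (z : 𝔻) :
    (toeplitzAut lam a g).eval z = aut lam a z * g.eval z := by
  have hH : IsHardy fun t => autBdry lam a t * g.bdry t :=
    (isHardy_autBdry lam a).bdd_mul (C := 1) (ae_of_all _ fun t => (norm_autBdry lam a t).le)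
      (isHardy_bdry g)
  have e : symbolMul (ContinuousMap.toLp ∞ arc ℂ (autBdry lam a)) g =
      ((hH.toH2 : H2) : Lp ℂ 2 arc) := by
    refine Lp.ext ?_
    filter_upwards [coeFn_symbolMul (ContinuousMap.toLp ∞ arc ℂ (autBdry lam a)) g,
      ContinuousMap.coeFn_toLp (p := ∞) (𝕜 := ℂ) arc (autBdry lam a), hH.bdry_toH2] with t h1 h2 h3
    rw [h1, h2]
    exact h3.symm
  have h : toeplitzAut lam a g = hH.toH2 := by
    rw [toeplitzAut, toeplitz_apply, e]
    exact Submodule.orthogonalProjectionOnto_mem_subspace_eq_self _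
  rw [h, hH.eval_toH2, (isHardy_autBdry lam a).cauchy_mul (isHardy_bdry g), Pi.mul_apply,
    cauchy_autBdry]
  rfl

/-- This intertwining carries near invariance between `T_ψ` and the shift. -/
theorem toeplitzAut_compAut (lam : Circle) (a : 𝔻) (f : H2) :
    toeplitzAut lam a (compAut lam a f) = compAut lam a (shift f) := by
  apply H2.eval_injective
  funext z
  rw [eval_toeplitzAut, eval_compAut, eval_compAut, Function.comp, Function.comp, eval_shift]

theorem aut_surjective (lam : Circle) (a : 𝔻) : Function.Surjective (aut lam a) := fun z =>
  ⟨_, aut_aut' lam a z⟩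

theorem compSet_injective (lam : Circle) (a : 𝔻) : Function.Injective (compSet (aut lam a)) :=
  Set.image_injective.mpr (aut_surjective lam a).injective_comp_right

theorem fns_eq_compSet (lam : Circle) (a : 𝔻) (M : Submodule ℂ H2) :
    fns M = compSet (aut lam a) (fns (compPreimage lam a M)) := by
  ext F
  simp only [compSet, fns, Set.mem_image, SetLike.mem_coe, exists_exists_and_eq_and]
  constructor
  · rintro ⟨f, hf, rfl⟩
    refine ⟨compAut lam⁻¹ (lam • a) f, ?_, ?_⟩
    · rwa [mem_compPreimage, compAut_compAut]
    · rw [← eval_compAut, compAut_compAut]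
  · rintro ⟨f, hf, rfl⟩
    exact ⟨compAut lam a f, mem_compPreimage.mp hf, eval_compAut lam a f⟩

theorem isClosed_compPreimage_iff (lam : Circle) (a : 𝔻) (M : Submodule ℂ H2) :
    IsClosed (compPreimage lam a M : Set H2) ↔ IsClosed (M : Set H2) := by
  constructor
  · intro h
    have e : (M : Set H2) = compAut lam⁻¹ (lam • a) ⁻¹' (compPreimage lam a M : Set H2) := by
      ext f
      rw [Set.mem_preimage, SetLike.mem_coe, SetLike.mem_coe, mem_compPreimage, compAut_compAut]
    rw [e]
    exact h.preimage (continuous_compAut lam⁻¹ (lam • a))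
  · intro h
    exact h.preimage (continuous_compAut lam a)

theorem nearlyInvariant_compPreimage_iff (lam : Circle) (a : 𝔻) (M : Submodule ℂ H2) :
    (∀ g, shift g ∈ compPreimage lam a M →
      g ∈ compPreimage lam a M) ↔ IsNearlyInvInvariant (toeplitzAut lam a) M := by
  simp only [mem_compPreimage, ← toeplitzAut_compAut]
  constructor
  · intro h g hg
    have := h (compAut lam⁻¹ (lam • a) g)
    rw [compAut_compAut] at this
    exact this hg
  · intro h g hg
    exact h _ hg

end HardyDisc

end

/-! ### The main theorem -/

theorem mainTheorem1 (lam : Circle) (a : 𝔻) :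
    -- the characterization of the closed nearly invariant subspaces
    (∀ M : Submodule ℂ H2,
      (IsClosed (M : Set H2) ∧ IsNearlyInvInvariant (toeplitzAut lam a) M) ↔
        ∃ u θ : H2, (IsInner θ ∨ θ = 0) ∧ u.eval 0 ≠ 0 ∧
          IsIsometricMultiplier u (modelSpace θ) ∧
          fns M = compSet (aut lam a) (mulSet u.eval (fns (modelSpace θ)))) ∧
    -- the specific forms; `Θ` is `θ ∘ ψ` and `χ` is `z (θ ∘ ψ) / ψ`
    (∀ u θ : H2, (IsInner θ ∨ θ = 0) →
      ∃ Θ : H2, Θ.eval = θ.eval ∘ aut lam a ∧ (IsInner θ → IsInner Θ) ∧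
        (∃ hG : MemLp (symbolFn lam a Θ) ∞ arc,
          compSet (aut lam a) (mulSet u.eval (fns (modelSpace θ))) =
            mulSet (u.eval ∘ aut lam a) (fns (toeplitzKer hG.toLp))) ∧
        (θ.eval 0 = 0 →
          ∃ χ : H2, (∀ z : 𝔻, χ.eval z * (aut lam a z : ℂ) = (z : ℂ) * θ.eval (aut lam a z)) ∧
            (IsInner θ → IsInner χ) ∧
            compSet (aut lam a) (mulSet u.eval (fns (modelSpace θ))) =
              mulSet (u.eval ∘ aut lam a) (fns (modelSpace χ))) ∧
        (θ.eval 0 ≠ 0 →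
          compSet (aut lam a) (mulSet u.eval (fns (modelSpace θ))) =
            mulSet ((fun z : 𝔻 => 1 - conj (a : ℂ) * (z : ℂ)) * (u.eval ∘ aut lam a))
              (fns (modelSpace Θ)))) := by
  refine ⟨fun M => ?_, fun u θ hθ => ?_⟩
  -- Everything is pulled back along `C_ψ`; as `C_ψ` is injective on sets of functions, Hitt's
  -- theorem and its converse for the preimage of `M` remain.
  · rw [← isClosed_compPreimage_iff lam a, ← nearlyInvariant_compPreimage_iff,
      fns_eq_compSet lam a M]
    simp only [(compSet_injective lam a).eq_iff]
    constructor
    · rintro ⟨h1, h2⟩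
      exact exists_fns_eq_mulSet_modelSpace h1 h2
    · rintro ⟨u, θ, -, hu, h, hN⟩
      exact isClosed_and_nearlyInvariant hu h hN
  · have hb := bdry_norm_le_one hθ
    have hG := memLp_symbolFn lam a (norm_bdry_compAut_le hb lam a)
    exact ⟨compAut lam a θ, eval_compAut lam a θ, fun h => h.compAut lam a,
      ⟨hG, compSet_modelSpace_eq_toeplitzKer lam a u hb hG⟩,
      fun h0 => exists_compSet_modelSpace_of_eval_eq_zero lam a u hb h0,
      fun _ => compSet_modelSpace_eq_one_sub_mul lam a u hb⟩
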